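/- \textbf{Setting.} A probabilistic program (PP) $P$ has finitely many real-valued variables $V$, output variables $V_{out}\subseteq V$, an initial valuation, and instructions for Borel-measurable (simultaneous) assignment, sampling from fixed probability distributions, branching/loops/go-to, and the conditioning instructions $\mathbf{observe}(\varphi)$ and $\mathbf{score}(e)$ with $e\ge 0$. Its probabilistic control-flow graph (pCFG) $\mathcal C(P)$ has finitely many locations; in each state $(\ell,\mathbf x)$ exactly one transition $\tau=(\ell,\ell')$ is enabled, and it leads to $(\ell',\mathbf N)$, where $\mathbf N$ is the random valuation resulting from the update of $\tau$. The terminal location $\ell_{out}$ has only a self-loop without updates. The transition $\tau$ carries the weight $w(\tau,\mathbf x)$, which is $e(\mathbf x)$ for $\mathbf{score}(e)$, the indicator of $\mathbf x\models\varphi$ for $\mathbf{observe}(\varphi)$, and $1$ otherwise. A run is an infinite sequence of successor states from the initial state (sampling may return any point of the support of its distribution). Let $\mathbb P,\mathbb E$ refer to the induced Markov process, let $T$ be the first time at which $\ell_{out}$ is reached, and let $W=\prod_{i<T}w((\ell_i,\ell_{i+1}),\mathbf x_i)$ be the cumulative weight. $P$ is a.s. terminating if $\mathbb P[T<\infty]=1$,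 integrable if $0<\mathbb E[W]<\infty$, and has cumulative weight bounded by $M>0$ if $W(\rho)\le M$ for every terminating run $\rho$. The normalized output distribution of an a.s. terminating, integrable $P$ is $\mu^{\mathcal C(P)}[B]=\mathbb E[\mathbb I_{\mathbf x_T^{out}\in B}\,W]/\mathbb E[W]$ for Borel $B\subseteq\mathbb R^{V_{out}}$; two programs with the same output variables are output equivalent if these distributions agree on all Borel sets. \textbf{Weighted restarting.} Given the bound $M$, $P_{res}$ is obtained from $P$ by adding a fresh variable $W$ with initial value $1$, replacing $\mathbf{observe}(\varphi)$ by ``if $\neg\varphi$: $W:=0$'' and $\mathbf{score}(e)$ by $W:=W\cdot e$, and adding at the end a block that with probability $1-W/M$ resets all variables to their initial values and goes back to the initial location, and otherwise terminates. (The probabilistic choice is a sample from the uniform distribution on $[0,1]$ into a fresh variable, followed by a comparison with $1-W/M$.) \textbf{Supermartingales.} Let $f:\mathbb R^{V_{out}}\to\mathbb R$ be Borel measurable. A UESM for $f$ in a pCFG is a family $U_f(\ell,\cdot)$ of Borel functions on valuations such that, for some set $I$ of states containing all reachable states, $U_f(\ell_{out},\mathbf x)=0$ whenever $(\ell_{out},\mathbf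 x)\in I$, and $U_f(\ell,\mathbf x)+f(\mathbf x^{out})\ge\mathbb E[U_f(\ell',\mathbf N)+f(\mathbf N^{out})]$ for every $(\ell,\mathbf x)\in I$ and enabled transition $(\ell,\ell')$; an LESM $L_f$ is defined with $\le$ instead. With $S_i=(\ell_i,\mathbf x_i)$ the $i$-th state and $Y_i=\eta(S_i)+f(\mathbf x_i^{out})$, $(\mathcal C,\eta,f)$ is OST-sound if $\mathbb E|Y_i|<\infty$ for all $i$ and at least one of the following holds: (C1) $T\le c$ a.s. for some constant $c$; (C2) for some constant $c$, $|Y_{\min\{t,T\}}|\le c$ for all $t$ and all runs; (C3) $\mathbb E[T]<\infty$ and, for some constant $c$, $\mathbb E[|Y_{t+1}-Y_t|\mid\mathcal F_t]\le c$ for all $t$, where $\mathcal F_t$ is generated by the states up to time $t$; (C4) there are reals $M',c_1,c_2,d$ with $c_2>0$ such that $\mathbb P(T>n)\le c_1e^{-c_2n}$ for all sufficiently large $n$, and $|Y_{n+1}-Y_n|\le M'n^d$ a.s. for all $n\ge1$. \textbf{Theorem.} Let $P^1,P^2$ be two a.s. terminating, integrable programs (possibly with conditioning) with the same output variables and with cumulative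 weights bounded by $M_1>0$ and $M_2>0$, respectively, and let $P^1_{res},P^2_{res}$ be obtained by weighted restarting with these bounds, with initial states $(\ell^i_{in},\mathbf x^i_{in})$ of $\mathcal C(P^i_{res})$. Assume that there are a Borel-measurable $f:\mathbb R^{V_{out}}\to\mathbb R$, a UESM $U_f$ for $f$ in $\mathcal C(P^1_{res})$ with $(\mathcal C(P^1_{res}),U_f,f)$ OST-sound, and an LESM $L_f$ for $f$ in $\mathcal C(P^2_{res})$ with $(\mathcal C(P^2_{res}),L_f,f)$ OST-sound, such that $$U_f(\ell^1_{in},\mathbf x^1_{in})+f((\mathbf x^1_{in})^{out})<L_f(\ell^2_{in},\mathbf x^2_{in})+f((\mathbf x^2_{in})^{out}).$$ Then $P^1$ and $P^2$ are not output equivalent. -/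

import Mathlib

open MeasureTheory ProbabilityTheory Set Filter
open scoped ENNReal NNReal

namespace PP

/-! ### Updates of program variables -/

/-- The update of one program variable: no update, a Borel-measurable expression over all the
program variables, or a sample from a probability distribution on `ℝ`. -/
inductive Update (V : Type*) where
  | keep : Update V
  | assign (e : (V → ℝ) → ℝ) (he : Measurable e) : Update V
  | sample (δ : ProbabilityMeasure ℝ) : Update V

namespace Update

variable {V : Type*}

/-- The law of the new value of the variable `v` when the update is applied to the valuation
`x`. -/
noncomputable def law (v : V) (x : V → ℝ) : Update V → Measure ℝ
  | keep => Measure.dirac (x v)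
  | assign e _ => Measure.dirac (e x)
  | sample δ => (δ : Measure ℝ)

/-- The real number `r` is a possible new value of the variable `v` when the update is applied to
the valuation `x`. A sampling instruction can return every point of the support of its
distribution. -/
def Possible (v : V) (x : V → ℝ) (r : ℝ) : Update V → Prop
  | keep => r = x v
  | assign e _ => r = e x
  | sample δ => r ∈ (δ : Measure ℝ).support

instance (v : V) (x : V → ℝ) (u : Update V) : IsProbabilityMeasure (u.law v x) := by
  cases u <;> simp only [law] <;> infer_instance

theorem measurable_law (v : V) (u : Update V) : Measurable fun x : V → ℝ => u.law v x := by
  cases u with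
  | keep => exact Measure.measurable_dirac.comp (measurable_pi_apply v)
  | assign e he => exact Measure.measurable_dirac.comp he
  | sample δ => exact measurable_const

end Update

/-! ### Probabilistic control-flow graphs with weights -/

/-- States of a pCFG: pairs of a location and a variable valuation. -/
def State (L V : Type*) : Type _ := L × (V → ℝ)

/-- The state with location `ℓ` and valuation `x`. -/
def State.mk {L V : Type*} (ℓ : L) (x : V → ℝ) : State L V := (ℓ, x)

/-- The product `σ`-algebra; all sets of locations are measurable. -/
instance (L V : Type*) : MeasurableSpace (State L V) :=
  @Prod.instMeasurableSpace L (V → ℝ) ⊤ inferInstance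

/-- Weighted probabilistic control-flow graphs with locations `L`, program variables `V` and output
variables `O`. The values of `guard`, `up` and `weight` matter only on transitions. -/
structure PCFG (L V O : Type*) where
  /-- The output variables, as a subset of the program variables. -/
  out : O ↪ V
  initLoc : L
  initVal : V → ℝ
  trans : Set (L × L)
  guard : L × L → Set (V → ℝ)
  up : L × L → V → Update V
  weight : L × L → (V → ℝ) → ℝ≥0
  termLoc : L
  measurableSet_guard : ∀ τ, MeasurableSet (guard τ)
  measurable_weight : ∀ τ, Measurable (weight τ)
  /-- In every state exactly one transition is enabled. -/
  existsUnique_enabled : ∀ (ℓ : L) (x : V → ℝ), ∃! ℓ' : L, (ℓ, ℓ') ∈ trans ∧ x ∈ guard (ℓ, ℓ')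
  /-- The only transition out of the terminal location is a self-loop without updates, so that
  runs can be taken to be infinite sequences. -/
  trans_termLoc : ∀ ℓ : L, (termLoc, ℓ) ∈ trans → ℓ = termLoc
  up_termLoc : ∀ v : V, up (termLoc, termLoc) v = Update.keep

namespace PCFG

variable {L V O : Type*} (C : PCFG L V O)

/-- Projection of a valuation to the output variables. -/
def outVal (x : V → ℝ) : O → ℝ := fun o => x (C.out o)

/-- The initial state. -/
def init : State L V := State.mk C.initLoc C.initVal

/-- The target of the unique transition enabled in `(ℓ, x)`. -/
noncomputable def nextLoc (ℓ : L) (x : V → ℝ) : L := (C.existsUnique_enabled ℓ x).choose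

theorem nextLoc_spec (ℓ : L) (x : V → ℝ) :
    (ℓ, C.nextLoc ℓ x) ∈ C.trans ∧ x ∈ C.guard (ℓ, C.nextLoc ℓ x) :=
  (C.existsUnique_enabled ℓ x).choose_spec.1

theorem nextLoc_eq_iff (ℓ ℓ' : L) (x : V → ℝ) :
    C.nextLoc ℓ x = ℓ' ↔ (ℓ, ℓ') ∈ C.trans ∧ x ∈ C.guard (ℓ, ℓ') :=
  ⟨fun h => h ▸ C.nextLoc_spec ℓ x,
    fun h => (C.existsUnique_enabled ℓ x).unique (C.nextLoc_spec ℓ x) h⟩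

/-- Law of the random valuation obtained by performing the transition `τ` from the valuation `x`.
All the variables are updated simultaneously, and the samples are independent. -/
noncomputable def nextLaw [Fintype V] (τ : L × L) (x : V → ℝ) : Measure (V → ℝ) :=
  Measure.pi fun v => (C.up τ v).law v x

instance [Fintype V] (τ : L × L) (x : V → ℝ) : IsProbabilityMeasure (C.nextLaw τ x) := by
  unfold nextLaw; infer_instance

theorem measurable_nextLaw [Fintype V] (τ : L × L) : Measurable fun x => C.nextLaw τ x := by
  refine Measurable.measure_of_isPiSystem_of_isProbabilityMeasure
    generateFrom_pi.symm isPiSystem_pi ?_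
  rintro _ ⟨s, hs, rfl⟩
  have hs' : ∀ v, MeasurableSet (s v) := fun v => hs v (mem_univ v)
  simp only [nextLaw, Measure.pi_pi]
  exact Finset.measurable_prod _ fun v _ =>
    (Measure.measurable_coe (hs' v)).comp ((C.up τ v).measurable_law v)

/-- The law of the successor of a state: take the enabled transition `(ℓ, ℓ')`, and apply its
update. -/
noncomputable def stepLaw [Fintype V] (s : State L V) : Measure (State L V) :=
  (C.nextLaw (s.1, C.nextLoc s.1 s.2) s.2).map (State.mk (C.nextLoc s.1 s.2))

theorem measurable_mk (ℓ : L) : Measurable (State.mk ℓ : (V → ℝ) → State L V) := by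
  let _ : MeasurableSpace L := ⊤
  exact (measurable_prodMk_left : Measurable fun y : V → ℝ => (ℓ, y))

theorem measurable_stepLaw [Fintype V] [Finite L] : Measurable C.stepLaw := by
  let _ : MeasurableSpace L := ⊤
  have hdisc : DiscreteMeasurableSpace L := ⟨fun _ => trivial⟩
  refine measurable_from_prod_countable_right (α := L) (β := V → ℝ) (f := C.stepLaw) fun ℓ => ?_
  have hnext : Measurable fun x : V → ℝ => C.nextLoc ℓ x := by
    refine measurable_to_countable' fun ℓ' => ?_
    have : (fun x : V → ℝ => C.nextLoc ℓ x) ⁻¹' {ℓ'} =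
        {x | (ℓ, ℓ') ∈ C.trans ∧ x ∈ C.guard (ℓ, ℓ')} := by
      ext x; exact C.nextLoc_eq_iff ℓ ℓ' x
    rw [this]
    exact (MeasurableSet.const _).inter (C.measurableSet_guard (ℓ, ℓ'))
  have hF : Measurable fun p : L × (V → ℝ) =>
      (C.nextLaw (ℓ, p.1) p.2).map (State.mk p.1) :=
    measurable_from_prod_countable_right fun ℓ' =>
      (Measure.measurable_map _ (measurable_mk ℓ')).comp (C.measurable_nextLaw (ℓ, ℓ'))
  exact hF.comp (hnext.prodMk measurable_id)

/-- The transition kernel of the Markov process over the states. -/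
noncomputable def step [Fintype V] [Finite L] : Kernel (State L V) (State L V) :=
  ⟨C.stepLaw, C.measurable_stepLaw⟩

instance [Fintype V] [Finite L] : IsMarkovKernel C.step :=
  ⟨fun _ => Measure.isProbabilityMeasure_map (measurable_mk _).aemeasurable⟩

/-- The law on sequences of states of the Markov process started in the initial state. -/
noncomputable def prob [Fintype V] [Finite L] : Measure (ℕ → State L V) :=
  Kernel.traj (X := fun _ => State L V)
    (fun n => C.step.comap (fun h : (i : Finset.Iic n) → State L V => h ⟨n, by simp⟩)
      (measurable_pi_apply _)) 0 (fun _ => C.init)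

instance [Fintype V] [Finite L] : IsProbabilityMeasure C.prob := by
  unfold prob; infer_instance

/-- `s'` is a successor of `s`: a transition enabled in `s` can lead to `s'`. -/
def Succ (s s' : State L V) : Prop :=
  (s.1, s'.1) ∈ C.trans ∧ s.2 ∈ C.guard (s.1, s'.1) ∧
    ∀ v, (C.up (s.1, s'.1) v).Possible v s.2 (s'.2 v)

/-- `s` is the last state of a finite path, that is, of a finite sequence of successor states that
begins in the initial state. -/
def Reachable (s : State L V) : Prop := Relation.ReflTransGen C.Succ C.init s

/-- Runs: infinite sequences of successor states that begin in the initial state. -/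
def IsRun (ρ : ℕ → State L V) : Prop := ρ 0 = C.init ∧ ∀ n, C.Succ (ρ n) (ρ (n + 1))

/-- The sequence reaches a terminal state. -/
def Terminates (ρ : ℕ → State L V) : Prop := ∃ n, (ρ n).1 = C.termLoc

/-- Termination time; `⊤` if no terminal state is reached. -/
noncomputable def termTime (ρ : ℕ → State L V) : ℕ∞ :=
  sInf {t : ℕ∞ | ∃ n : ℕ, t = n ∧ (ρ n).1 = C.termLoc}

open Classical in
/-- Cumulative weight of a terminating sequence of states (`0` by convention if it does not
terminate). -/
noncomputable def cumWeight (ρ : ℕ → State L V) : ℝ≥0 :=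
  if C.Terminates ρ then
    ∏ i ∈ Finset.range (C.termTime ρ).toNat, C.weight ((ρ i).1, (ρ (i + 1)).1) (ρ i).2
  else 0

/-- Almost-sure termination. -/
def AlmostSurelyTerminating [Fintype V] [Finite L] : Prop :=
  ∀ᵐ ρ ∂C.prob, C.Terminates ρ

/-- The expected cumulative weight. -/
noncomputable def expWeight [Fintype V] [Finite L] : ℝ≥0∞ :=
  ∫⁻ ρ, (C.cumWeight ρ : ℝ≥0∞) ∂C.prob

/-- Integrability: the expected cumulative weight is positive and finite. -/
def IntegrableWeight [Fintype V] [Finite L] : Prop :=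
  0 < C.expWeight ∧ C.expWeight < ⊤

/-- The cumulative weight of every terminating run is at most `M`. -/
def WeightBoundedBy (M : ℝ) : Prop :=
  ∀ ρ, C.IsRun ρ → C.Terminates ρ → (C.cumWeight ρ : ℝ) ≤ M

/-- The event that the output is in `B`. -/
def outputIn (B : Set (O → ℝ)) : Set (ℕ → State L V) :=
  {ρ | ∃ n, (ρ n).1 = C.termLoc ∧ C.outVal (ρ n).2 ∈ B}

/-- The normalized output distribution. -/
noncomputable def nod [Fintype V] [Finite L] (B : Set (O → ℝ)) : ℝ≥0∞ :=
  (∫⁻ ρ, (C.outputIn B).indicator (fun ρ => (C.cumWeight ρ : ℝ≥0∞)) ρ ∂C.prob) / C.expWeight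

/-! ### Expectation supermartingales and submartingales, and OST-soundness -/

/-- State functions: a Borel-measurable function of the valuation for every location. -/
def IsStateFunction (η : L → (V → ℝ) → ℝ) : Prop := ∀ ℓ, Measurable (η ℓ)

/-- Invariants: predicate functions that contain all reachable states. -/
def IsInvariant (I : L → Set (V → ℝ)) : Prop :=
  ∀ (ℓ : L) (x : V → ℝ), C.Reachable (State.mk ℓ x) → x ∈ I ℓ

end PCFG

/-- For a measurable function `X`: the expectation of `X` exists in `[-∞, ∞)` and is at most `a`.
(If the positive part has a finite integral and `X` is not integrable, then the expectation
is `-∞`.) -/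
def ExpectationLE {Ω : Type*} [MeasurableSpace Ω] (μ : Measure Ω) (X : Ω → ℝ) (a : ℝ) : Prop :=
  ∫⁻ ω, ENNReal.ofReal (X ω) ∂μ < ⊤ ∧ (Integrable X μ → ∫ ω, X ω ∂μ ≤ a)

/-- For a measurable function `X`: the expectation of `X` exists in `(-∞, ∞]` and is at least
`a`. -/
def ExpectationGE {Ω : Type*} [MeasurableSpace Ω] (μ : Measure Ω) (X : Ω → ℝ) (a : ℝ) : Prop :=
  ∫⁻ ω, ENNReal.ofReal (-X ω) ∂μ < ⊤ ∧ (Integrable X μ → a ≤ ∫ ω, X ω ∂μ)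

namespace PCFG

variable {L V O : Type*} (C : PCFG L V O)

/-- `U` is an upper expectation supermartingale for `f` with respect to the invariant `I`. -/
structure IsUESMOn [Fintype V] (I : L → Set (V → ℝ)) (f : (O → ℝ) → ℝ)
    (U : L → (V → ℝ) → ℝ) : Prop where
  stateFunction : IsStateFunction U
  zero_on_output : ∀ x ∈ I C.termLoc, U C.termLoc x = 0
  expected_decrease : ∀ ℓ ℓ', (ℓ, ℓ') ∈ C.trans → ∀ x ∈ I ℓ, x ∈ C.guard (ℓ, ℓ') →
    ExpectationLE (C.nextLaw (ℓ, ℓ') x) (fun y => U ℓ' y + f (C.outVal y))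
      (U ℓ x + f (C.outVal x))

/-- `U` is a lower expectation submartingale for `f` with respect to the invariant `I`. -/
structure IsLESMOn [Fintype V] (I : L → Set (V → ℝ)) (f : (O → ℝ) → ℝ)
    (U : L → (V → ℝ) → ℝ) : Prop where
  stateFunction : IsStateFunction U
  zero_on_output : ∀ x ∈ I C.termLoc, U C.termLoc x = 0
  expected_increase : ∀ ℓ ℓ', (ℓ, ℓ') ∈ C.trans → ∀ x ∈ I ℓ, x ∈ C.guard (ℓ, ℓ') →
    ExpectationGE (C.nextLaw (ℓ, ℓ') x) (fun y => U ℓ' y + f (C.outVal y))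
      (U ℓ x + f (C.outVal x))

/-- Upper expectation supermartingale for `f` (with respect to some invariant). -/
def IsUESM [Fintype V] (f : (O → ℝ) → ℝ) (U : L → (V → ℝ) → ℝ) : Prop :=
  ∃ I, C.IsInvariant I ∧ C.IsUESMOn I f U

/-- Lower expectation submartingale for `f` (with respect to some invariant). -/
def IsLESM [Fintype V] (f : (O → ℝ) → ℝ) (U : L → (V → ℝ) → ℝ) : Prop :=
  ∃ I, C.IsInvariant I ∧ C.IsLESMOn I f U

/-- The process `Y i = η (S i) + f (x i ^ out)`, where `S i` is the `i`-th state and `x i` its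
valuation. -/
def valueAt (η : L → (V → ℝ) → ℝ) (f : (O → ℝ) → ℝ) (i : ℕ) (ρ : ℕ → State L V) : ℝ :=
  η (ρ i).1 (ρ i).2 + f (C.outVal (ρ i).2)

/-- OST-soundness of `(C, η, f)`. The filtration `Filtration.piLE` is generated by the first states
of the sequence. -/
structure OSTSound [Fintype V] [Finite L] (η : L → (V → ℝ) → ℝ) (f : (O → ℝ) → ℝ) : Prop where
  integrable : ∀ i, Integrable (C.valueAt η f i) C.prob
  cond :
    -- bounded termination time
    (∃ c : ℕ, ∀ᵐ ρ ∂C.prob, C.termTime ρ ≤ c) ∨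
    -- the process is uniformly bounded along every run, up to termination
    (∃ c : ℝ, ∀ (t : ℕ) (ρ : ℕ → State L V), C.IsRun ρ →
      |C.valueAt η f (min (t : ℕ∞) (C.termTime ρ)).toNat ρ| ≤ c) ∨
    -- integrable termination time and bounded expected one-step changes
    (∫⁻ ρ, (C.termTime ρ : ℝ≥0∞) ∂C.prob < ⊤ ∧
      ∃ c : ℝ, ∀ t : ℕ,
        C.prob[fun ρ => |C.valueAt η f (t + 1) ρ - C.valueAt η f t ρ|
          | Filtration.piLE (X := fun _ : ℕ => State L V) t] ≤ᵐ[C.prob] fun _ => c) ∨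
    -- exponential tails of the termination time and polynomially bounded one-step changes
    (∃ M c₁ c₂ d : ℝ, 0 < c₂ ∧
      (∀ᶠ n : ℕ in atTop, C.prob.real {ρ | (n : ℕ∞) < C.termTime ρ} ≤ c₁ * Real.exp (-c₂ * n)) ∧
      ∀ n : ℕ, 1 ≤ n → ∀ᵐ ρ ∂C.prob,
        |C.valueAt η f (n + 1) ρ - C.valueAt η f n ρ| ≤ M * (n : ℝ) ^ d)

end PCFG

/-! ### Probabilistic programs -/

/-- Instructions of a program with control points `A`. After an instruction the control passes to
the next point that the program prescribes, except for a `branch` whose predicate fails. -/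
inductive Instr (A V : Type*) where
  /-- Simultaneous assignments to and sampling of program variables. If no variable is updated,
  this is `skip`, or a go-to. -/
  | update (u : V → Update V) : Instr A V
  /-- If `φ` holds, pass to the next point, else go to `a`. -/
  | branch (φ : Set (V → ℝ)) (hφ : MeasurableSet φ) (a : A) : Instr A V
  | observe (φ : Set (V → ℝ)) (hφ : MeasurableSet φ) : Instr A V
  | score (e : (V → ℝ) → ℝ≥0) (he : Measurable e) : Instr A V

/-- Imperative probabilistic programs with labelled instructions: `L` is the set of labels. A
control point is a label or the exit `none`, where the program returns its output variables.
Sequential composition, `if`, `while` and go-to are expressed by `branch` and `next`. -/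
structure Program (L V O : Type*) where
  instr : L → Instr (Option L) V
  next : L → Option L
  start : Option L
  initVal : V → ℝ
  out : O ↪ V

namespace Program

variable {L V O : Type*}

/-- The transitions in the pCFG of a program: one for every possible flow of control, and a
self-loop at the exit. -/
def trans (P : Program L V O) : Set (Option L × Option L) :=
  {τ | match τ.1 with
    | none => τ.2 = none
    | some ℓ => match P.instr ℓ with
      | .branch _ _ a => τ.2 = P.next ℓ ∨ τ.2 = a
      | _ => τ.2 = P.next ℓ}

/-- The guards in the pCFG of a program. -/
def guard (P : Program L V O) (τ : Option L × Option L) : Set (V → ℝ) :=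
  match τ.1 with
  | none => univ
  | some ℓ => match P.instr ℓ with
    | .branch φ _ a => {x | (x ∈ φ ∧ τ.2 = P.next ℓ) ∨ (x ∉ φ ∧ τ.2 = a)}
    | _ => univ

/-- The updates in the pCFG of a program. -/
def up (P : Program L V O) (τ : Option L × Option L) : V → Update V :=
  match τ.1 with
  | none => fun _ => .keep
  | some ℓ => match P.instr ℓ with
    | .update u => u
    | _ => fun _ => .keep

open Classical in
/-- The weights in the pCFG of a program. -/
noncomputable def weight (P : Program L V O) (τ : Option L × Option L) : (V → ℝ) → ℝ≥0 :=
  match τ.1 with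
  | none => fun _ => 1
  | some ℓ => match P.instr ℓ with
    | .observe φ _ => fun x => if x ∈ φ then 1 else 0
    | .score e _ => e
    | _ => fun _ => 1

/-- The pCFG of a program. Its locations are the control points; the exit is terminal. -/
noncomputable def toPCFG (P : Program L V O) : PCFG (Option L) V O where
  out := P.out
  initLoc := P.start
  initVal := P.initVal
  trans := P.trans
  guard := P.guard
  up := P.up
  weight := P.weight
  termLoc := none
  measurableSet_guard := by
    rintro ⟨_ | ℓ, a'⟩
    · exact MeasurableSet.univ
    · simp only [guard]
      cases P.instr ℓ with
      | branch φ hφ a =>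
        exact (hφ.inter (MeasurableSet.const _)).union (hφ.compl.inter (MeasurableSet.const _))
      | _ => exact MeasurableSet.univ
  measurable_weight := by
    rintro ⟨_ | ℓ, a'⟩
    · exact measurable_const
    · simp only [weight]
      cases P.instr ℓ with
      | observe φ hφ => exact Measurable.ite hφ measurable_const measurable_const
      | score e he => exact he
      | _ => exact measurable_const
  existsUnique_enabled := by
    rintro (_ | ℓ) x
    · exact ⟨none, ⟨rfl, trivial⟩, fun _ h => h.1⟩
    · simp only [trans, guard, mem_ofPred_eq]
      cases P.instr ℓ with
      | branch φ hφ a =>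
        by_cases hx : x ∈ φ
        · exact ⟨P.next ℓ, ⟨Or.inl rfl, Or.inl ⟨hx, rfl⟩⟩, fun y hy => by
            rcases hy.2 with h | h
            · exact h.2
            · exact absurd hx h.1⟩
        · exact ⟨a, ⟨Or.inr rfl, Or.inr ⟨hx, rfl⟩⟩, fun y hy => by
            rcases hy.2 with h | h
            · exact absurd h.1 hx
            · exact h.2⟩
      | _ => exact ⟨P.next ℓ, ⟨rfl, trivial⟩, fun y hy => hy.1⟩
  trans_termLoc := fun _ h => h
  up_termLoc := fun _ => rfl

/-- Two programs with the same output variables are output equivalent if their normalized output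
distributions agree on all Borel sets. -/
def OutputEquivalent {L₁ V₁ L₂ V₂ O : Type*} [Finite L₁] [Fintype V₁] [Finite L₂] [Fintype V₂]
    (P₁ : Program L₁ V₁ O) (P₂ : Program L₂ V₂ O) : Prop :=
  ∀ B : Set (O → ℝ), MeasurableSet B → P₁.toPCFG.nod B = P₂.toPCFG.nod B

/-- The instruction at `ℓ` is an `observe`. -/
def IsObserve (P : Program L V O) (ℓ : L) : Prop := ∃ φ hφ, P.instr ℓ = .observe φ hφ

end Program

/-! ### Weighted restarting -/

/-- The variables of the restarted program: those of the program, the fresh weight variable, and a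
fresh variable that holds the sample of the probabilistic branching. -/
inductive ResVar (V : Type*) where
  | orig (v : V) : ResVar V
  | weight : ResVar V
  | coin : ResVar V

instance (V : Type*) [Fintype V] : Fintype (ResVar V) :=
  Fintype.ofEquiv (V ⊕ Bool)
    { toFun := fun s => match s with
        | .inl v => .orig v
        | .inr true => .weight
        | .inr false => .coin
      invFun := fun s => match s with
        | .orig v => .inl v
        | .weight => .inr true
        | .coin => .inr false
      left_inv := by rintro (v | _ | _) <;> rfl
      right_inv := by rintro (v | _ | _) <;> rfl }

/-- The labels of the restarted program: those of the program, a label `W := 0` for every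
`observe`, and the labels of the block that is added at the end. -/
inductive ResLabel {L V O : Type*} (P : Program L V O) where
  | orig (ℓ : L) : ResLabel P
  | zero (ℓ : L) (h : P.IsObserve ℓ) : ResLabel P
  | draw : ResLabel P
  | test : ResLabel P
  | reset : ResLabel P

instance {L V O : Type*} (P : Program L V O) [Finite L] : Finite (ResLabel P) :=
  Finite.of_injective
    (fun s : ResLabel P => (match s with
      | .orig ℓ => (some ℓ, 0)
      | .zero ℓ _ => (some ℓ, 1)
      | .draw => (none, 0)
      | .test => (none, 1)
      | .reset => (none, 2) : Option L × Fin 3))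
    (by rintro (_ | _ | _ | _ | _) (_ | _ | _ | _ | _) h <;> simp_all)

/-- The valuation of the original variables. -/
def origVal {V : Type*} (x : ResVar V → ℝ) : V → ℝ := fun v => x (.orig v)

theorem measurable_origVal {V : Type*} : Measurable (origVal : (ResVar V → ℝ) → V → ℝ) :=
  measurable_pi_lambda _ fun _ => measurable_pi_apply _

/-- The update of an original variable, as an update over the variables of the restarted
program. -/
def Update.lift {V : Type*} : Update V → Update (ResVar V)
  | keep => keep
  | assign e he => assign (fun x => e (origVal x)) (he.comp measurable_origVal)
  | sample δ => sample δ

/-- The update that sets `W` to the value of the expression `e`, and nothing else. -/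
def setWeight {V : Type*} (e : (ResVar V → ℝ) → ℝ) (he : Measurable e) :
    ResVar V → Update (ResVar V)
  | .orig _ => .keep
  | .weight => .assign e he
  | .coin => .keep

/-- The uniform distribution on the unit interval. -/
noncomputable def uniform01 : ProbabilityMeasure ℝ :=
  ⟨volume.restrict (Icc (0 : ℝ) 1), ⟨by simp⟩⟩

namespace Program

variable {L V O : Type*}

/-- Control points of the program as control points of the restarted program: instead of exiting,
go to the block that is added at the end. -/
def liftPoint (P : Program L V O) : Option L → Option (ResLabel P)
  | none => some .draw
  | some ℓ => some (.orig ℓ)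

/-- The instruction of the restarted program at a label of the program: `observe φ` becomes
`if ¬φ: W := 0`, and `score e` becomes `W := W * e`. -/
noncomputable def resInstr (P : Program L V O) (ℓ : L) :
    Instr (Option (ResLabel P)) (ResVar V) :=
  match h : P.instr ℓ with
  | .update u => .update fun
    | .orig v => (u v).lift
    | .weight => .keep
    | .coin => .keep
  | .branch φ hφ a => .branch (origVal ⁻¹' φ) (measurable_origVal hφ) (P.liftPoint a)
  | .observe φ hφ =>
    .branch (origVal ⁻¹' φ) (measurable_origVal hφ) (some (.zero ℓ ⟨φ, hφ, h⟩))
  | .score e he =>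
    .update (setWeight (fun x => x .weight * (e (origVal x) : ℝ))
      ((measurable_pi_apply _).mul (he.comp measurable_origVal).coe_nnreal_real))

/-- Weighted restarting with the bound `M`. The added block is
`coin := sample(Uniform[0,1]); if coin ≤ 1 - W / M: (x := x_in; W := 1; go-to start)`, which restarts
with probability `1 - W / M`. The restarting assignment resets all the variables, so that it leads
back to the initial state. -/
noncomputable def restart (P : Program L V O) (M : ℝ) : Program (ResLabel P) (ResVar V) O where
  instr
    | .orig ℓ => P.resInstr ℓ
    | .zero _ _ => .update (setWeight (fun _ => 0) measurable_const)
    | .draw => .update fun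
      | .orig _ => .keep
      | .weight => .keep
      | .coin => .sample uniform01
    | .test => .branch {x | x .coin ≤ 1 - x .weight / M}
        (measurableSet_le (by fun_prop) (by fun_prop)) none
    | .reset => .update fun
      | .orig v => .assign (fun _ => P.initVal v) measurable_const
      | .weight => .assign (fun _ => 1) measurable_const
      | .coin => .assign (fun _ => 0) measurable_const
  next
    | .orig ℓ => P.liftPoint (P.next ℓ)
    | .zero ℓ _ => P.liftPoint (P.next ℓ)
    | .draw => some .test
    | .test => some .reset
    | .reset => P.liftPoint P.start
  start := P.liftPoint P.start
  initVal
    | .orig v => P.initVal v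
    | .weight => 1
    | .coin => 0
  out := P.out.trans ⟨ResVar.orig, fun _ _ h => by injection h⟩

end Program

end PP

/-! The proof has two independent halves.

Optional stopping. After termination the states of a run are constant, so `valueAt` is already a
stopped process. For a UESM its expectations are at most the initial value, by the Markov property
and because the invariant contains almost every state that occurs
(`PP.PCFG.IsUESM.integral_valueAt_le`). Each condition of OST-soundness allows dominated
convergence: the process is bounded, or its one-step changes have summable expectations
(`PP.PCFG.OSTSound.tendsto_integral`). So the expected value of `f` at the output is at most the
initial value of an OST-sound UESM, and dually at least that of an OST-sound LESM.

Weighted restarting. The output law of the restarted program is the normalized output distribution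
of the program (`PP.Program.map_output_restart`). A direct coupling of the two programs is avoided,
since a failing `observe` takes an additional step in the restarted program. Instead, let `h` be the
probability, as a function of the state, that the restarted program terminates with an output
in `B`. It is harmonic, and thus a supermartingale along the states of the original program, paired
with the cumulative weight `W`. By Fatou's lemma, its initial value `α` satisfies
`α ≥ 𝔼[(1 - W / M) * α + W / M * 1_B(out)]`, hence `α * 𝔼[W] ≥ 𝔼[W * 1_B(out)]`
(`PP.Program.nod_le_prob_restart`). This lower bound for `B` and for its complement adds up to `1`,
so both are equalities, and the restarted program terminates almost surely.

If the two programs were output equivalent, then `f` would have the same expectation at the outputs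
of the two restarted programs, against the strict inequality between the initial values. -/

namespace PP

/-! ### Measurability on the state space -/

namespace State

variable {L V : Type*}

theorem measurable_val : Measurable (fun s : State L V => s.2) := by
  let _ : MeasurableSpace L := ⊤
  exact (measurable_snd : Measurable fun p : L × (V → ℝ) => p.2)

theorem measurableSet_loc_eq (ℓ : L) : MeasurableSet {s : State L V | s.1 = ℓ} := by
  let _ : MeasurableSpace L := ⊤
  have hfst : Measurable fun p : L × (V → ℝ) => p.1 := measurable_fst
  exact hfst (t := {ℓ}) trivial

/-- A function of a state is measurable as soon as it is a measurable function of the valuation at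
each of the finitely many locations. -/
theorem measurable_of_loc [Finite L] {β : Type*} [MeasurableSpace β] {F : L → (V → ℝ) → β}
    (hF : ∀ ℓ, Measurable (F ℓ)) : Measurable fun s : State L V => F s.1 s.2 := by
  let _ : MeasurableSpace L := ⊤
  have hdisc : DiscreteMeasurableSpace L := ⟨fun _ => trivial⟩
  exact measurable_from_prod_countable_right (α := L) (β := V → ℝ)
    (f := fun s => F s.1 s.2) hF

theorem measurable_of_loc_prod [Finite L] {α β : Type*} [MeasurableSpace α] [MeasurableSpace β]
    {F : L → (V → ℝ) → α → β} (hF : ∀ ℓ, Measurable fun q : (V → ℝ) × α => F ℓ q.1 q.2) :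
    Measurable fun p : State L V × α => F p.1.1 p.1.2 p.2 := by
  let _ : MeasurableSpace L := ⊤
  have hdisc : DiscreteMeasurableSpace L := ⟨fun _ => trivial⟩
  have h : Measurable fun q : L × ((V → ℝ) × α) => F q.1 q.2.1 q.2.2 :=
    measurable_from_prod_countable_right hF
  have h' : Measurable fun p : (L × (V → ℝ)) × α => (p.1.1, (p.1.2, p.2)) := by fun_prop
  exact h.comp h'

instance [Countable V] : MeasurableSingletonClass (State L V) := by
  let _ : MeasurableSpace L := ⊤
  have hdisc : DiscreteMeasurableSpace L := ⟨fun _ => trivial⟩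
  exact (inferInstance : MeasurableSingletonClass (L × (V → ℝ)))

end State

theorem Update.ae_possible {V : Type*} (v : V) (x : V → ℝ) (u : Update V) :
    ∀ᵐ r ∂u.law v x, u.Possible v x r := by
  cases u with
  | keep => exact (ae_dirac_iff (measurableSet_singleton _)).2 rfl
  | assign e he => exact (ae_dirac_iff (measurableSet_singleton _)).2 rfl
  | sample δ => exact Measure.support_mem_ae

theorem Update.measurableSet_possible {V : Type*} (v : V) (u : Update V) :
    MeasurableSet {p : (V → ℝ) × ℝ | u.Possible v p.1 p.2} := by
  cases u with
  | keep => exact measurableSet_eq_fun measurable_snd (by fun_prop)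
  | assign e he => exact measurableSet_eq_fun measurable_snd (by fun_prop)
  | sample δ => exact measurable_snd Measure.isClosed_support.measurableSet

namespace PCFG

variable {L V O : Type*} (C : PCFG L V O)

theorem measurable_outVal : Measurable C.outVal :=
  measurable_pi_lambda _ fun _ => measurable_pi_apply _

/-- The weight of the transition that is enabled in a state. -/
noncomputable def stepWeight (s : State L V) : ℝ≥0 := C.weight (s.1, C.nextLoc s.1 s.2) s.2

theorem measurable_nextLoc [Countable L] (ℓ : L) :
    @Measurable _ _ _ ⊤ fun x : V → ℝ => C.nextLoc ℓ x := by
  let _ : MeasurableSpace L := ⊤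
  refine measurable_to_countable' fun ℓ' => ?_
  have : (fun x : V → ℝ => C.nextLoc ℓ x) ⁻¹' {ℓ'} =
      {x | (ℓ, ℓ') ∈ C.trans ∧ x ∈ C.guard (ℓ, ℓ')} := by
    ext x; exact C.nextLoc_eq_iff ℓ ℓ' x
  rw [this]
  exact (MeasurableSet.const _).inter (C.measurableSet_guard (ℓ, ℓ'))

theorem measurable_stepWeight [Finite L] : Measurable C.stepWeight := by
  refine State.measurable_of_loc (F := fun ℓ x => C.weight (ℓ, C.nextLoc ℓ x) x) fun ℓ => ?_
  let _ : MeasurableSpace L := ⊤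
  have hdisc : DiscreteMeasurableSpace L := ⟨fun _ => trivial⟩
  have hF : Measurable fun p : L × (V → ℝ) => C.weight (ℓ, p.1) p.2 :=
    measurable_from_prod_countable_right fun ℓ' => C.measurable_weight (ℓ, ℓ')
  exact hF.comp ((C.measurable_nextLoc ℓ).prodMk measurable_id)

/-! ### Runs -/

variable {C}

theorem Succ.nextLoc_eq {s s' : State L V} (h : C.Succ s s') : C.nextLoc s.1 s.2 = s'.1 :=
  (C.nextLoc_eq_iff _ _ _).2 ⟨h.1, h.2.1⟩

theorem Succ.eq_of_term {s s' : State L V} (h : C.Succ s s') (hs : s.1 = C.termLoc) : s' = s := by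
  obtain ⟨ℓ, x⟩ := s
  obtain ⟨ℓ', x'⟩ := s'
  obtain rfl : ℓ = C.termLoc := hs
  obtain rfl : ℓ' = C.termLoc := C.trans_termLoc _ h.1
  have hx : x' = x := by
    funext v
    have := h.2.2 v
    rw [C.up_termLoc] at this
    exact this
  rw [hx]

theorem IsRun.eq_of_le {ρ : ℕ → State L V} (hρ : C.IsRun ρ) {n m : ℕ}
    (hn : (ρ n).1 = C.termLoc) (hm : n ≤ m) : ρ m = ρ n := by
  induction m, hm using Nat.le_induction with
  | base => rfl
  | succ k hk ih => rw [(hρ.2 k).eq_of_term (by rw [ih, hn]), ih]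

theorem IsRun.reachable {ρ : ℕ → State L V} (hρ : C.IsRun ρ) (n : ℕ) : C.Reachable (ρ n) := by
  induction n with
  | zero => rw [hρ.1]; exact Relation.ReflTransGen.refl
  | succ k ih => exact ih.tail (hρ.2 k)

theorem termTime_le {ρ : ℕ → State L V} {n : ℕ} (h : (ρ n).1 = C.termLoc) :
    C.termTime ρ ≤ n :=
  sInf_le ⟨n, rfl, h⟩

theorem Terminates.exists_termTime {ρ : ℕ → State L V} (h : C.Terminates ρ) :
    ∃ n : ℕ, C.termTime ρ = n ∧ (ρ n).1 = C.termLoc := by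
  obtain ⟨n, hn⟩ := h
  exact csInf_mem (s := {t : ℕ∞ | ∃ n : ℕ, t = n ∧ (ρ n).1 = C.termLoc}) ⟨n, n, rfl, hn⟩

theorem IsRun.term_of_le {ρ : ℕ → State L V} (hρ : C.IsRun ρ) {m : ℕ}
    (h : C.termTime ρ ≤ m) : (ρ m).1 = C.termLoc := by
  have hT : C.Terminates ρ := by
    by_contra hT
    have : {t : ℕ∞ | ∃ n : ℕ, t = n ∧ (ρ n).1 = C.termLoc} = ∅ :=
      Set.eq_empty_of_forall_notMem fun t ⟨n, _, hn⟩ => hT ⟨n, hn⟩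
    simp [termTime, this] at h
  obtain ⟨n, hn, hn'⟩ := hT.exists_termTime
  rw [hn, Nat.cast_le] at h
  rw [hρ.eq_of_le hn' h, hn']

variable (C) in
/-- The values of the output variables at the termination time. If no terminal state is reached,
then `toNat` takes `⊤` to `0`, and these are the values in the first state. -/
noncomputable def output (ρ : ℕ → State L V) : O → ℝ := C.outVal (ρ (C.termTime ρ).toNat).2

theorem IsRun.output_eq {ρ : ℕ → State L V} (hρ : C.IsRun ρ) {n : ℕ}
    (hn : (ρ n).1 = C.termLoc) : C.output ρ = C.outVal (ρ n).2 := by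
  obtain ⟨k, hk, hk'⟩ := Terminates.exists_termTime ⟨n, hn⟩
  have hkn : k ≤ n := by exact_mod_cast hk ▸ termTime_le hn
  rw [output, hk, ENat.toNat_natCast, hρ.eq_of_le hk' hkn]

theorem IsRun.mem_outputIn_iff {ρ : ℕ → State L V} (hρ : C.IsRun ρ) (hT : C.Terminates ρ)
    (B : Set (O → ℝ)) : ρ ∈ C.outputIn B ↔ C.output ρ ∈ B := by
  constructor
  · rintro ⟨n, hn, hB⟩
    rwa [hρ.output_eq hn]
  · intro hB
    obtain ⟨n, hn⟩ := hT
    exact ⟨n, hn, by rwa [← hρ.output_eq hn]⟩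

theorem measurableSet_outputIn {B : Set (O → ℝ)} (hB : MeasurableSet B) :
    MeasurableSet (C.outputIn B) := by
  have : C.outputIn B = ⋃ n, (fun ρ : ℕ → State L V => ρ n) ⁻¹'
      ({s | s.1 = C.termLoc} ∩ {s | C.outVal s.2 ∈ B}) := by
    ext ρ; simp [outputIn]
  rw [this]
  exact MeasurableSet.iUnion fun n => measurable_pi_apply n
    ((State.measurableSet_loc_eq _).inter
      ((C.measurable_outVal.comp State.measurable_val) hB))

/-- On a terminating run, the cumulative weight can be computed up to any time after
termination if the terminal self-loop has weight `1`. -/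
theorem IsRun.cumWeight_eq {ρ : ℕ → State L V} (hρ : C.IsRun ρ)
    (hw : ∀ x, C.weight (C.termLoc, C.termLoc) x = 1) {n : ℕ} (hn : (ρ n).1 = C.termLoc) :
    C.cumWeight ρ = ∏ i ∈ Finset.range n, C.stepWeight (ρ i) := by
  have hT : C.Terminates ρ := ⟨n, hn⟩
  obtain ⟨k, hk, hk'⟩ := hT.exists_termTime
  have hkn : k ≤ n := by exact_mod_cast hk ▸ termTime_le hn
  rw [cumWeight, if_pos hT, hk, ENat.toNat_natCast]
  have hstep : ∀ i, C.stepWeight (ρ i) = C.weight ((ρ i).1, (ρ (i + 1)).1) (ρ i).2 := fun i => by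
    rw [stepWeight, (hρ.2 i).nextLoc_eq]
  simp only [← hstep]
  refine Finset.prod_subset (Finset.range_subset_range.2 hkn) fun i _ hi => ?_
  have hki : k ≤ i := by simpa using hi
  have h1 : (ρ i).1 = C.termLoc := by rw [hρ.eq_of_le hk' hki, hk']
  have h2 : (ρ (i + 1)).1 = C.termLoc := by rw [hρ.eq_of_le hk' (hki.trans i.le_succ), hk']
  rw [hstep, h1, h2, hw]

/-! ### The Markov property -/

variable (C) in
theorem ae_nextLaw_possible [Fintype V] (τ : L × L) (x : V → ℝ) :
    ∀ᵐ y ∂C.nextLaw τ x, ∀ v, (C.up τ v).Possible v x (y v) :=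
  eventually_all.2 fun v => (Measure.tendsto_eval_ae_ae (μ := fun v => (C.up τ v).law v x)
    (i := v)).eventually ((C.up τ v).ae_possible v x)

variable [Fintype V] [Finite L]

variable (C) in
theorem step_apply (s : State L V) :
    C.step s = (C.nextLaw (s.1, C.nextLoc s.1 s.2) s.2).map (State.mk (C.nextLoc s.1 s.2)) :=
  rfl

variable (C) in
theorem lintegral_step (s : State L V) {g : State L V → ℝ≥0∞} (hg : Measurable g) :
    ∫⁻ s', g s' ∂C.step s =
      ∫⁻ y, g (State.mk (C.nextLoc s.1 s.2) y) ∂C.nextLaw (s.1, C.nextLoc s.1 s.2) s.2 := by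
  rw [step_apply, lintegral_map hg (measurable_mk _)]

variable (C) in
theorem measurableSet_succ :
    MeasurableSet {p : State L V × State L V | C.Succ p.1 p.2} := by
  have : {p : State L V × State L V | C.Succ p.1 p.2} = ⋃ τ : L × L,
      (Prod.fst ⁻¹' {s | s.1 = τ.1} ∩ Prod.snd ⁻¹' {s | s.1 = τ.2}) ∩
      ({p | τ ∈ C.trans} ∩ {p | p.1.2 ∈ C.guard τ} ∩
        ⋂ v, {p | (C.up τ v).Possible v p.1.2 (p.2.2 v)}) := by
    ext p
    simp only [mem_ofPred_eq, mem_iUnion, mem_inter_iff, mem_preimage, mem_iInter]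
    constructor
    · exact fun h => ⟨(p.1.1, p.2.1), ⟨rfl, rfl⟩, ⟨h.1, h.2.1⟩, h.2.2⟩
    · rintro ⟨⟨ℓ, ℓ'⟩, ⟨h1, h2⟩, ⟨h3, h4⟩, h5⟩
      dsimp only at h1 h2
      subst h1 h2
      exact ⟨h3, h4, h5⟩
  rw [this]
  have hx : Measurable fun p : State L V × State L V => p.1.2 :=
    State.measurable_val.comp measurable_fst
  have hy : Measurable fun p : State L V × State L V => p.2.2 :=
    State.measurable_val.comp measurable_snd
  refine MeasurableSet.iUnion fun τ => ?_
  refine ((measurable_fst (State.measurableSet_loc_eq _)).inter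
    (measurable_snd (State.measurableSet_loc_eq _))).inter
    (((MeasurableSet.const _).inter (hx (C.measurableSet_guard τ))).inter
      (MeasurableSet.iInter fun v => ?_))
  exact (hx.prodMk ((measurable_pi_apply v).comp hy)) (Update.measurableSet_possible v (C.up τ v))

variable (C) in
theorem ae_succ (s : State L V) : ∀ᵐ s' ∂C.step s, C.Succ s s' := by
  have hm : MeasurableSet {s' | C.Succ s s'} := measurable_prodMk_left C.measurableSet_succ
  refine (ae_map_iff (measurable_mk _).aemeasurable hm).2 ?_
  have h := C.nextLoc_spec s.1 s.2
  filter_upwards [C.ae_nextLaw_possible (s.1, C.nextLoc s.1 s.2) s.2] with y hy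
  exact ⟨h.1, h.2, hy⟩

variable (C) in
/-- The Markov property: given the first states, the law of the next state is that of the successor
of the last of them. -/
theorem prob_map_succ (n : ℕ) :
    (C.prob.map (Preorder.frestrictLe (π := fun _ : ℕ => State L V) n)) ⊗ₘ
      (C.step.comap (fun h : (i : Finset.Iic n) → State L V => h ⟨n, by simp⟩)
        (measurable_pi_apply _)) =
    C.prob.map (fun ρ => (Preorder.frestrictLe (π := fun _ : ℕ => State L V) n ρ, ρ (n + 1))) := by
  have h := Kernel.partialTraj_compProd_eq_map_traj (X := fun _ => State L V)
    (κ := fun n => C.step.comap (fun h : (i : Finset.Iic n) → State L V => h ⟨n, by simp⟩)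
      (measurable_pi_apply _)) n.zero_le (x₀ := fun _ => C.init)
  rw [← Kernel.traj_map_frestrictLe_apply] at h
  exact h

variable (C) in
theorem lintegral_prob_succ (n : ℕ)
    {F : ((i : Finset.Iic n) → State L V) → State L V → ℝ≥0∞}
    (hF : Measurable (Function.uncurry F)) :
    ∫⁻ ρ, F (fun i => ρ i) (ρ (n + 1)) ∂C.prob =
      ∫⁻ ρ, ∫⁻ s', F (fun i => ρ i) s' ∂C.step (ρ n) ∂C.prob := by
  have h := congrArg (fun μ => ∫⁻ p, Function.uncurry F p ∂μ) (C.prob_map_succ n)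
  rw [lintegral_map hF (by fun_prop), Measure.lintegral_compProd hF, lintegral_map _ (by fun_prop)]
    at h
  · exact h.symm
  · exact hF.lintegral_kernel_prod_right'

variable (C) in
/-- The joint law of the states at two consecutive times. -/
theorem prob_map_pair (n : ℕ) :
    (C.prob.map (fun ρ => ρ n)) ⊗ₘ C.step = C.prob.map (fun ρ => (ρ n, ρ (n + 1))) := by
  ext s hs
  have hm : Measurable fun ρ : ℕ → State L V => (ρ n, ρ (n + 1)) := by fun_prop
  have hp : Measurable fun p : ((i : Finset.Iic n) → State L V) × State L V =>
      (p.1 ⟨n, by simp⟩, p.2) := by fun_prop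
  have := C.lintegral_prob_succ n (F := fun h s' => s.indicator 1 (h ⟨n, by simp⟩, s'))
    ((measurable_one.indicator hs).comp hp)
  rw [Measure.compProd_apply hs, lintegral_map (Kernel.measurable_kernel_prodMk_left hs)
    (measurable_pi_apply n), ← lintegral_indicator_one hs,
    lintegral_map (measurable_one.indicator hs) hm, this]
  refine lintegral_congr fun ρ => ?_
  have hs' : MeasurableSet (Prod.mk (ρ n) ⁻¹' s) := measurable_prodMk_left hs
  rw [← lintegral_indicator_one hs']
  rfl

variable (C) in
theorem prob_map_zero : C.prob.map (fun ρ => ρ 0) = Measure.dirac C.init := by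
  have h : C.prob.map (Preorder.frestrictLe (π := fun _ : ℕ => State L V) 0) =
      Measure.dirac (fun _ => C.init) := by
    rw [prob, Kernel.traj_map_frestrictLe_apply, Kernel.partialTraj_self, Kernel.id_apply]
  have h2 := congrArg (Measure.map (fun h : (i : Finset.Iic 0) → State L V => h ⟨0, by simp⟩)) h
  rwa [Measure.map_map (by fun_prop) (by fun_prop), Measure.map_dirac' (by fun_prop)] at h2

variable (C) in
/-- Almost every sequence of states is a run, since samples are almost surely in the support of their
distribution. So facts about all runs, or all reachable states, hold almost surely. -/
theorem ae_isRun : ∀ᵐ ρ ∂C.prob, C.IsRun ρ := by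
  refine Filter.Eventually.and ?_ (ae_all_iff.2 fun n => ?_)
  · refine ae_of_ae_map (μ := C.prob) (f := fun ρ => ρ 0) (p := fun s => s = C.init)
      (measurable_pi_apply 0).aemeasurable ?_
    rw [prob_map_zero]
    exact (ae_dirac_iff (measurableSet_singleton _)).2 rfl
  · refine ae_of_ae_map (μ := C.prob) (f := fun ρ => (ρ n, ρ (n + 1)))
      (p := fun p => C.Succ p.1 p.2) (by fun_prop) ?_
    rw [← prob_map_pair]
    exact Measure.ae_compProd_of_ae_ae C.measurableSet_succ (ae_of_all _ fun s => C.ae_succ s)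

theorem aemeasurable_output (hT : C.AlmostSurelyTerminating) :
    AEMeasurable C.output C.prob := by
  have : Finite O := Finite.of_injective _ C.out.injective
  refine aemeasurable_of_tendsto_metrizable_ae' (f := fun n ρ => C.outVal (ρ n).2)
    (fun n => (C.measurable_outVal.comp
      (State.measurable_val.comp (measurable_pi_apply n))).aemeasurable) ?_
  filter_upwards [hT, C.ae_isRun] with ρ ⟨n, hn⟩ hρ
  refine tendsto_const_nhds.congr' (eventually_atTop.2 ⟨n, fun m hm => ?_⟩)
  simp only [hρ.output_eq hn, hρ.eq_of_le hn hm]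

theorem map_output_apply (hT : C.AlmostSurelyTerminating) {B : Set (O → ℝ)}
    (hB : MeasurableSet B) : C.prob.map C.output B = C.prob (C.outputIn B) := by
  rw [Measure.map_apply_of_aemeasurable (aemeasurable_output hT) hB]
  refine measure_congr ?_
  filter_upwards [hT, C.ae_isRun] with ρ hT hρ
  exact propext (hρ.mem_outputIn_iff hT B).symm

end PCFG
end PP

/-! ### Optional stopping -/

namespace PP.PCFG

variable {L V O : Type*} {C : PCFG L V O}

theorem IsRun.valueAt_eq {ρ : ℕ → State L V} (hρ : C.IsRun ρ) {η : L → (V → ℝ) → ℝ}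
    {f : (O → ℝ) → ℝ} {n m : ℕ} (hn : (ρ n).1 = C.termLoc) (hm : n ≤ m) :
    C.valueAt η f m ρ = C.valueAt η f n ρ := by
  simp only [valueAt, hρ.eq_of_le hn hm]

/-- The function `η + f` of the state whose value at the `i`-th state is `valueAt η f i`. -/
def stateValue (C : PCFG L V O) (η : L → (V → ℝ) → ℝ) (f : (O → ℝ) → ℝ) (s : State L V) : ℝ :=
  η s.1 s.2 + f (C.outVal s.2)

theorem measurable_stateValue [Finite L] {η : L → (V → ℝ) → ℝ} {f : (O → ℝ) → ℝ} (hη : IsStateFunction η)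
    (hf : Measurable f) : Measurable (C.stateValue η f) :=
  State.measurable_of_loc (F := fun ℓ x => η ℓ x + f (C.outVal x))
    fun ℓ => (hη ℓ).add (hf.comp C.measurable_outVal)

/-- The event that the process has not terminated at time `n`. -/
def running (C : PCFG L V O) (n : ℕ) : Set (ℕ → State L V) := {ρ | (ρ n).1 ≠ C.termLoc}

theorem measurableSet_running (n : ℕ) : MeasurableSet (C.running n) :=
  (State.measurableSet_loc_eq C.termLoc).compl.preimage (measurable_pi_apply n)

theorem measurableSet_running_piLE (n : ℕ) :
    MeasurableSet[Filtration.piLE (X := fun _ : ℕ => State L V) n] (C.running n) := by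
  rw [Filtration.piLE_eq_comap_frestrictLe]
  exact ⟨{h | (h ⟨n, by simp⟩).1 ≠ C.termLoc},
    (State.measurableSet_loc_eq C.termLoc).compl.preimage (measurable_pi_apply _), rfl⟩

/-- After termination the value does not change. -/
theorem IsRun.enorm_valueAt_sub {ρ : ℕ → State L V} (hρ : C.IsRun ρ) {η : L → (V → ℝ) → ℝ}
    {f : (O → ℝ) → ℝ} (n : ℕ) :
    ‖C.valueAt η f (n + 1) ρ - C.valueAt η f n ρ‖ₑ = (C.running n).indicator
      (fun ρ => ‖C.valueAt η f (n + 1) ρ - C.valueAt η f n ρ‖ₑ) ρ := by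
  by_cases h : ρ ∈ C.running n
  · rw [indicator_of_mem h]
  · rw [indicator_of_notMem h, hρ.valueAt_eq (not_not.1 h) n.le_succ, sub_self, enorm_zero]

theorem IsRun.lt_termTime_of_mem_running {ρ : ℕ → State L V} (hρ : C.IsRun ρ) {n : ℕ}
    (h : ρ ∈ C.running n) : (n : ℕ∞) < C.termTime ρ :=
  not_le.1 fun hle => h (hρ.term_of_le hle)

theorem IsLESM.neg {f : (O → ℝ) → ℝ} [Fintype V] {U : L → (V → ℝ) → ℝ} (hU : C.IsLESM f U) :
    C.IsUESM (fun x => -f x) (fun ℓ x => -U ℓ x) := by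
  obtain ⟨I, hI, hU⟩ := hU
  refine ⟨I, hI, fun ℓ => (hU.stateFunction ℓ).neg, fun x hx => ?_, fun ℓ ℓ' h x hx hg => ?_⟩
  · rw [hU.zero_on_output x hx, neg_zero]
  · obtain ⟨h1, h2⟩ := hU.expected_increase ℓ ℓ' h x hx hg
    have : (fun y => -U ℓ' y + -f (C.outVal y)) = fun y => -(U ℓ' y + f (C.outVal y)) := by
      funext y; ring
    refine this ▸ ⟨h1, fun hi => ?_⟩
    rw [integral_neg, ← neg_add]
    exact neg_le_neg (h2 (integrable_neg_iff.1 hi))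

variable [Fintype V] [Finite L]

/-- Along a UESM the expected value does not increase. -/
theorem IsUESM.integral_valueAt_succ_le {f : (O → ℝ) → ℝ} (hf : Measurable f)
    {U : L → (V → ℝ) → ℝ} (hU : C.IsUESM f U)
    (hint : ∀ i, Integrable (C.valueAt U f i) C.prob) (n : ℕ) :
    ∫ ρ, C.valueAt U f (n + 1) ρ ∂C.prob ≤ ∫ ρ, C.valueAt U f n ρ ∂C.prob := by
  obtain ⟨I, hI, hU⟩ := hU
  have hm := measurable_stateValue (C := C) hU.stateFunction hf
  have hmn : Measurable fun ρ : ℕ → State L V => ρ n := measurable_pi_apply n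
  have hmp : Measurable fun ρ : ℕ → State L V => (ρ n, ρ (n + 1)) := by fun_prop
  have hint' : Integrable (fun p : State L V × State L V => C.stateValue U f p.2)
      ((C.prob.map fun ρ => ρ n) ⊗ₘ C.step) := by
    rw [C.prob_map_pair n]
    exact (integrable_map_measure (hm.comp measurable_snd).aestronglyMeasurable
      hmp.aemeasurable).2 (hint (n + 1))
  have hint1 : Integrable (fun s => ∫ s', C.stateValue U f s' ∂C.step s)
      (C.prob.map fun ρ => ρ n) := by
    rw [Measure.compProd] at hint'
    simpa using hint'.integral_compProd
  have h1 : ∫ ρ, C.valueAt U f (n + 1) ρ ∂C.prob =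
      ∫ ρ, ∫ s', C.stateValue U f s' ∂C.step (ρ n) ∂C.prob := by
    calc ∫ ρ, C.valueAt U f (n + 1) ρ ∂C.prob
        = ∫ p, C.stateValue U f p.2 ∂(C.prob.map fun ρ => (ρ n, ρ (n + 1))) :=
          (integral_map hmp.aemeasurable (hm.comp measurable_snd).aestronglyMeasurable).symm
      _ = ∫ s, ∫ s', C.stateValue U f s' ∂C.step s ∂(C.prob.map fun ρ => ρ n) := by
          rw [← C.prob_map_pair n, Measure.integral_compProd hint']
      _ = _ := integral_map hmn.aemeasurable
          hint1.aestronglyMeasurable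
  rw [h1]
  have hint2 : Integrable (fun ρ => ∫ s', C.stateValue U f s' ∂C.step (ρ n)) C.prob :=
    hint1.comp_measurable hmn
  have hint3 : ∀ᵐ ρ ∂C.prob, Integrable (C.stateValue U f) (C.step (ρ n)) :=
    ae_of_ae_map hmn.aemeasurable
      ((Measure.integrable_compProd_iff hint'.aestronglyMeasurable).1 hint').1
  refine integral_mono_ae hint2 (hint n) ?_
  filter_upwards [hint3, C.ae_isRun] with ρ hρi hρ
  obtain ⟨h, h'⟩ := C.nextLoc_spec (ρ n).1 (ρ n).2
  have hstep := hU.expected_decrease _ _ h (ρ n).2 (hI _ _ (hρ.reachable n)) h'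
  have hρi' := (integrable_map_measure hm.aestronglyMeasurable
    (measurable_mk _).aemeasurable).1 hρi
  refine le_trans (le_of_eq ?_) (hstep.2 hρi')
  exact integral_map (measurable_mk _).aemeasurable hm.aestronglyMeasurable

theorem IsUESM.integral_valueAt_le {f : (O → ℝ) → ℝ} (hf : Measurable f)
    {U : L → (V → ℝ) → ℝ} (hU : C.IsUESM f U)
    (hint : ∀ i, Integrable (C.valueAt U f i) C.prob) (n : ℕ) :
    ∫ ρ, C.valueAt U f n ρ ∂C.prob ≤ U C.initLoc C.initVal + f (C.outVal C.initVal) := by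
  induction n with
  | zero =>
    have : ∀ᵐ ρ ∂C.prob, C.valueAt U f 0 ρ = U C.initLoc C.initVal + f (C.outVal C.initVal) := by
      filter_upwards [C.ae_isRun] with ρ hρ
      rw [valueAt, hρ.1]
      rfl
    rw [integral_congr_ae this]
    simp
  | succ n ih => exact (hU.integral_valueAt_succ_le hf hint n).trans ih

theorem lintegral_enorm_valueAt_sub (η : L → (V → ℝ) → ℝ) (f : (O → ℝ) → ℝ) (n : ℕ) :
    ∫⁻ ρ, ‖C.valueAt η f (n + 1) ρ - C.valueAt η f n ρ‖ₑ ∂C.prob =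
      ∫⁻ ρ in C.running n, ‖C.valueAt η f (n + 1) ρ - C.valueAt η f n ρ‖ₑ ∂C.prob := by
  rw [← lintegral_indicator (measurableSet_running n)]
  refine lintegral_congr_ae ?_
  filter_upwards [C.ae_isRun] with ρ hρ
  exact hρ.enorm_valueAt_sub n

/-- The tail sum of the termination time. -/
theorem tsum_running_le :
    ∑' n, C.prob (C.running n) ≤ ∫⁻ ρ, (C.termTime ρ : ℝ≥0∞) ∂C.prob := by
  have : ∀ n, C.prob (C.running n) = ∫⁻ ρ, (C.running n).indicator 1 ρ ∂C.prob := fun n =>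
    (lintegral_indicator_one (measurableSet_running n)).symm
  simp only [this]
  rw [← lintegral_tsum fun n => (measurable_one.indicator (measurableSet_running n)).aemeasurable]
  refine lintegral_mono_ae ?_
  filter_upwards [C.ae_isRun] with ρ hρ
  by_cases hT : C.termTime ρ = ⊤
  · simp [hT]
  obtain ⟨N, hN⟩ := ENat.ne_top_iff_exists.1 hT
  rw [tsum_eq_sum (s := Finset.range N)]
  · refine (Finset.sum_le_sum (g := fun _ => 1) fun n _ => ?_).trans ?_
    · exact indicator_le_self' (by simp) ρ
    · simp [← hN]
  · intro n hn
    refine indicator_of_notMem (fun h => hn ?_) _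
    have := hρ.lt_termTime_of_mem_running h
    rw [← hN, Nat.cast_lt] at this
    exact Finset.mem_range.2 this

/-- If the changes of the value are summable in expectation, then optional stopping holds by
dominated convergence. -/
theorem tendsto_integral_of_tsum_ne_top (hT : C.AlmostSurelyTerminating) {η : L → (V → ℝ) → ℝ}
    {f : (O → ℝ) → ℝ} (hint : ∀ i, Integrable (C.valueAt η f i) C.prob)
    {Y : (ℕ → State L V) → ℝ}
    (hY : ∀ᵐ ρ ∂C.prob, ∀ n, (ρ n).1 = C.termLoc → C.valueAt η f n ρ = Y ρ)
    (hsum : ∑' n, ∫⁻ ρ, ‖C.valueAt η f (n + 1) ρ - C.valueAt η f n ρ‖ₑ ∂C.prob ≠ ⊤) :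
    Tendsto (fun n => ∫ ρ, C.valueAt η f n ρ ∂C.prob) atTop (nhds (∫ ρ, Y ρ ∂C.prob)) := by
  have hsub : ∀ n, AEMeasurable
      (fun ρ => ‖C.valueAt η f (n + 1) ρ - C.valueAt η f n ρ‖ₑ) C.prob := fun n =>
    ((hint (n + 1)).sub (hint n)).aestronglyMeasurable.enorm
  rw [← lintegral_tsum hsub] at hsum
  have hlim : ∀ᵐ ρ ∂C.prob, Tendsto (fun n => C.valueAt η f n ρ) atTop (nhds (Y ρ)) := by
    filter_upwards [hT, C.ae_isRun, hY] with ρ ⟨n, hn⟩ hρ hY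
    refine tendsto_const_nhds.congr' (eventually_atTop.2 ⟨n, fun m hm => ?_⟩)
    simp only [hρ.valueAt_eq hn hm, hY n hn]
  set D : (ℕ → State L V) → ℝ≥0∞ := fun ρ =>
    ∑' n, ‖C.valueAt η f (n + 1) ρ - C.valueAt η f n ρ‖ₑ with hD
  have hDm : AEMeasurable D C.prob := AEMeasurable.tsum hsub
  refine tendsto_integral_of_dominated_convergence
    (fun ρ => |C.valueAt η f 0 ρ| + (D ρ).toReal) (fun n => (hint n).aestronglyMeasurable)
    ((hint 0).abs.add (integrable_toReal_of_lintegral_ne_top hDm hsum)) (fun n => ?_) hlim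
  filter_upwards [ae_lt_top' hDm hsum] with ρ hρ
  have hpart : ∀ n, ‖C.valueAt η f n ρ‖ₑ ≤ ‖C.valueAt η f 0 ρ‖ₑ +
      ∑ i ∈ Finset.range n, ‖C.valueAt η f (i + 1) ρ - C.valueAt η f i ρ‖ₑ := fun n => by
    induction n with
    | zero => simp
    | succ n ih =>
      rw [Finset.sum_range_succ, ← add_assoc]
      calc ‖C.valueAt η f (n + 1) ρ‖ₑ
          = ‖C.valueAt η f n ρ + (C.valueAt η f (n + 1) ρ - C.valueAt η f n ρ)‖ₑ := by
            rw [add_sub_cancel]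
        _ ≤ _ := (enorm_add_le _ _).trans (add_le_add_left ih _)
  have h := (hpart n).trans (add_le_add_right (ENNReal.sum_le_tsum _) _)
  have h2 := ENNReal.toReal_mono (by finiteness) h
  rwa [ENNReal.toReal_add (by finiteness) hρ.ne, toReal_enorm, toReal_enorm] at h2

theorem tsum_ne_top_of_eventually_le {a : ℕ → ℝ≥0∞} {b : ℕ → ℝ} (ha : ∀ n, a n ≠ ⊤)
    (hb : Summable b) (hab : ∀ᶠ n in atTop, a n ≤ ENNReal.ofReal (b n)) : ∑' n, a n ≠ ⊤ := by
  obtain ⟨N, hN⟩ := eventually_atTop.1 hab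
  rw [← ENNReal.summable.sum_add_tsum_nat_add' (k := N)]
  refine ENNReal.add_ne_top.2 ⟨ENNReal.sum_ne_top.2 fun n _ => ha n, ?_⟩
  refine ne_top_of_le_ne_top ?_ (ENNReal.tsum_le_tsum fun n => hN (n + N) (Nat.le_add_left _ _))
  exact ((summable_nat_add_iff N).2 hb).tsum_ofReal_ne_top

/-- Optional stopping: under OST-soundness the expected values converge to the expected value at
termination. Apart from the bounded case, the change at time `n` vanishes outside the event of not
having terminated, and so its expectation is summable in `n`. -/
theorem OSTSound.tendsto_integral {η : L → (V → ℝ) → ℝ} {f : (O → ℝ) → ℝ}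
    (h : C.OSTSound η f) (hT : C.AlmostSurelyTerminating) {Y : (ℕ → State L V) → ℝ}
    (hY : ∀ᵐ ρ ∂C.prob, ∀ n, (ρ n).1 = C.termLoc → C.valueAt η f n ρ = Y ρ) :
    Tendsto (fun n => ∫ ρ, C.valueAt η f n ρ ∂C.prob) atTop (nhds (∫ ρ, Y ρ ∂C.prob)) := by
  have hfin : ∀ n, ∫⁻ ρ, ‖C.valueAt η f (n + 1) ρ - C.valueAt η f n ρ‖ₑ ∂C.prob ≠ ⊤ := fun n =>
    ((h.integrable (n + 1)).sub (h.integrable n)).hasFiniteIntegral.ne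
  rcases h.cond with ⟨c, hc⟩ | ⟨c, hc⟩ | ⟨hT', c, hc⟩ | ⟨M, c₁, c₂, d, hc₂, htail, hM⟩
  · refine tendsto_integral_of_tsum_ne_top hT h.integrable hY ?_
    refine tsum_ne_top_of_eventually_le hfin (b := 0) summable_zero
      (eventually_atTop.2 ⟨c, fun n hn => ?_⟩)
    refine le_of_eq ?_
    rw [Pi.zero_apply, ENNReal.ofReal_zero]
    refine (lintegral_congr_ae (g := fun _ => 0) ?_).trans lintegral_zero
    filter_upwards [hc, C.ae_isRun] with ρ hρc hρ
    have hle : C.termTime ρ ≤ n := hρc.trans (by exact_mod_cast hn)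
    rw [hρ.valueAt_eq (hρ.term_of_le hle) n.le_succ, sub_self, enorm_zero]
  · refine tendsto_integral_of_dominated_convergence (fun _ => c)
      (fun n => (h.integrable n).aestronglyMeasurable) (integrable_const c) (fun n => ?_) ?_
    · filter_upwards [hT, C.ae_isRun] with ρ hT hρ
      obtain ⟨k, hk, hk'⟩ := hT.exists_termTime
      have := hc n ρ hρ
      rw [hk] at this
      rcases le_total n k with hnk | hnk
      · rwa [min_eq_left (Nat.cast_le.2 hnk), ENat.toNat_natCast] at this
      · rwa [min_eq_right (Nat.cast_le.2 hnk), ENat.toNat_natCast, ← hρ.valueAt_eq hk' hnk] at this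
    · filter_upwards [hT, C.ae_isRun, hY] with ρ ⟨n, hn⟩ hρ hY
      refine tendsto_const_nhds.congr' (eventually_atTop.2 ⟨n, fun m hm => ?_⟩)
      simp only [hρ.valueAt_eq hn hm, hY n hn]
  · refine tendsto_integral_of_tsum_ne_top hT h.integrable hY ?_
    -- The conditional bound can be used on the event of not having terminated, which belongs to the
    -- past.
    have hle : ∀ n, ∫⁻ ρ, ‖C.valueAt η f (n + 1) ρ - C.valueAt η f n ρ‖ₑ ∂C.prob ≤
        ENNReal.ofReal c * C.prob (C.running n) := fun n => by
      have hi : Integrable (fun ρ => |C.valueAt η f (n + 1) ρ - C.valueAt η f n ρ|) C.prob :=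
        ((h.integrable (n + 1)).sub (h.integrable n)).abs
      rw [lintegral_enorm_valueAt_sub]
      have hset := setIntegral_condExp ((Filtration.piLE (X := fun _ : ℕ => State L V)).le n) hi
        (measurableSet_running_piLE (C := C) n)
      calc _ = ENNReal.ofReal (∫ ρ in C.running n,
              |C.valueAt η f (n + 1) ρ - C.valueAt η f n ρ| ∂C.prob) := by
            rw [ofReal_integral_eq_lintegral_ofReal hi.integrableOn
              (ae_of_all _ fun _ => abs_nonneg _)]
            exact lintegral_congr fun ρ => by rw [← Real.norm_eq_abs, ofReal_norm]
        _ ≤ ENNReal.ofReal (∫ _ in C.running n, c ∂C.prob) := by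
            refine ENNReal.ofReal_le_ofReal (hset.symm.le.trans ?_)
            exact setIntegral_mono_ae integrable_condExp.integrableOn
              (integrable_const c).integrableOn (hc n)
        _ = _ := by
            rw [setIntegral_const, smul_eq_mul, mul_comm, ENNReal.ofReal_mul' measureReal_nonneg,
              ofReal_measureReal]
    refine ne_top_of_le_ne_top ?_ (ENNReal.tsum_le_tsum hle)
    rw [ENNReal.tsum_mul_left]
    exact ENNReal.mul_ne_top ENNReal.ofReal_ne_top (ne_top_of_le_ne_top hT'.ne tsum_running_le)
  · refine tendsto_integral_of_tsum_ne_top hT h.integrable hY ?_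
    -- The power `n ^ d` with a real exponent is bounded by one with a natural exponent.
    obtain ⟨k, hk⟩ := exists_nat_ge d
    have hb : Summable fun n : ℕ => (|M| * c₁) * ((n : ℝ) ^ k * Real.exp (-c₂ * n)) :=
      (Real.summable_pow_mul_exp_neg_nat_mul k hc₂).mul_left _
    refine tsum_ne_top_of_eventually_le hfin hb ?_
    filter_upwards [htail, eventually_ge_atTop 1] with n hn hn1
    have hn1' : (1 : ℝ) ≤ n := by exact_mod_cast hn1
    have hpow : (n : ℝ) ^ d ≤ (n : ℝ) ^ k := by
      rw [← Real.rpow_natCast]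
      exact Real.rpow_le_rpow_of_exponent_le hn1' hk
    have hrun : C.prob.real (C.running n) ≤ c₁ * Real.exp (-c₂ * n) := by
      refine le_trans (ENNReal.toReal_mono (measure_ne_top _ _) (measure_mono_ae ?_)) hn
      filter_upwards [C.ae_isRun] with ρ hρ hmem
      exact hρ.lt_termTime_of_mem_running hmem
    calc _ = ∫⁻ ρ in C.running n, ‖C.valueAt η f (n + 1) ρ - C.valueAt η f n ρ‖ₑ ∂C.prob :=
          lintegral_enorm_valueAt_sub η f n
      _ ≤ ∫⁻ _ in C.running n, ENNReal.ofReal (|M| * (n : ℝ) ^ k) ∂C.prob := by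
          refine lintegral_mono_ae (ae_restrict_of_ae ?_)
          filter_upwards [hM n hn1] with ρ hρ
          rw [← ofReal_norm, Real.norm_eq_abs]
          refine ENNReal.ofReal_le_ofReal (hρ.trans ?_)
          exact mul_le_mul (le_abs_self M) hpow (by positivity) (abs_nonneg M)
      _ = ENNReal.ofReal (|M| * (n : ℝ) ^ k * C.prob.real (C.running n)) := by
          rw [setLIntegral_const, ENNReal.ofReal_mul (p := |M| * (n : ℝ) ^ k) (by positivity),
            ofReal_measureReal]
      _ ≤ _ := by
          refine ENNReal.ofReal_le_ofReal ?_
          calc _ ≤ |M| * (n : ℝ) ^ k * (c₁ * Real.exp (-c₂ * n)) := by gcongr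
            _ = _ := by ring

/-- An OST-sound UESM bounds the expected value of `f` at the output from above. -/
theorem IsUESM.integral_output_le {f : (O → ℝ) → ℝ} (hf : Measurable f)
    {U : L → (V → ℝ) → ℝ} (hU : C.IsUESM f U) (h : C.OSTSound U f)
    (hT : C.AlmostSurelyTerminating) :
    ∫ ρ, f (C.output ρ) ∂C.prob ≤ U C.initLoc C.initVal + f (C.outVal C.initVal) := by
  refine le_of_tendsto (h.tendsto_integral hT ?_)
    (Eventually.of_forall fun n => hU.integral_valueAt_le hf h.integrable n)
  obtain ⟨I, hI, hU⟩ := hU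
  filter_upwards [C.ae_isRun] with ρ hρ n hn
  have hmem : (ρ n).2 ∈ I C.termLoc := hn ▸ hI (ρ n).1 (ρ n).2 (hρ.reachable n)
  rw [valueAt, hρ.output_eq hn, hn, hU.zero_on_output _ hmem, zero_add]

theorem OSTSound.neg {f : (O → ℝ) → ℝ} {U : L → (V → ℝ) → ℝ} (h : C.OSTSound U f) :
    C.OSTSound (fun ℓ x => -U ℓ x) (fun x => -f x) := by
  have hneg : ∀ n, C.valueAt (fun ℓ x => -U ℓ x) (fun x => -f x) n =
      fun ρ => -C.valueAt U f n ρ := fun n => by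
    funext ρ; simp only [valueAt]; ring
  have habs : ∀ n (ρ : ℕ → State L V), |-C.valueAt U f (n + 1) ρ - -C.valueAt U f n ρ| =
      |C.valueAt U f (n + 1) ρ - C.valueAt U f n ρ| := fun n ρ => by
    rw [← abs_neg]; congr 1; ring
  refine ⟨fun i => ?_, ?_⟩
  · rw [hneg]; exact (h.integrable i).neg
  · simp only [hneg, habs, abs_neg]
    exact h.cond

/-- An OST-sound LESM bounds the expected value of `f` at the output from below. -/
theorem IsLESM.le_integral_output {f : (O → ℝ) → ℝ} (hf : Measurable f)
    {U : L → (V → ℝ) → ℝ} (hU : C.IsLESM f U) (h : C.OSTSound U f)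
    (hT : C.AlmostSurelyTerminating) :
    U C.initLoc C.initVal + f (C.outVal C.initVal) ≤ ∫ ρ, f (C.output ρ) ∂C.prob := by
  have := hU.neg.integral_output_le (f := fun x => -f x) hf.neg h.neg hT
  rw [integral_neg] at this
  linarith

end PP.PCFG

/-! ### The probability of an output, from an arbitrary state -/

namespace PP

namespace PCFG

variable {L V O : Type*} (C : PCFG L V O)

theorem measurableSet_term_out {B : Set (O → ℝ)} (hB : MeasurableSet B) :
    MeasurableSet {s : State L V | s.1 = C.termLoc ∧ C.outVal s.2 ∈ B} :=
  (State.measurableSet_loc_eq _).inter ((C.measurable_outVal.comp State.measurable_val) hB)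

variable [Fintype V] [Finite L]

/-- The probability that the process started in a state has terminated with an output in `B`
after a given number of steps. -/
noncomputable def hitValue (B : Set (O → ℝ)) : ℕ → State L V → ℝ≥0∞
  | 0 => {s | s.1 = C.termLoc ∧ C.outVal s.2 ∈ B}.indicator 1
  | n + 1 => fun s => ∫⁻ s', hitValue B n s' ∂C.step s

/-- The probability that the process started in a state terminates with an output in `B`. -/
noncomputable def hitProb (B : Set (O → ℝ)) (s : State L V) : ℝ≥0∞ := ⨆ n, C.hitValue B n s

variable {C}
variable {B : Set (O → ℝ)}

theorem measurable_hitValue (hB : MeasurableSet B) (n : ℕ) : Measurable (C.hitValue B n) := by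
  induction n with
  | zero => exact measurable_one.indicator (C.measurableSet_term_out hB)
  | succ n ih => exact ih.lintegral_kernel

theorem measurable_hitProb (hB : MeasurableSet B) : Measurable (C.hitProb B) :=
  Measurable.iSup fun n => measurable_hitValue hB n

theorem hitValue_le_succ (n : ℕ) (s : State L V) : C.hitValue B n s ≤ C.hitValue B (n + 1) s := by
  induction n generalizing s with
  | zero =>
    by_cases hs : s ∈ {s : State L V | s.1 = C.termLoc ∧ C.outVal s.2 ∈ B}
    · have : ∫⁻ s', C.hitValue B 0 s' ∂C.step s = ∫⁻ _, C.hitValue B 0 s ∂C.step s := by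
        refine lintegral_congr_ae ?_
        filter_upwards [C.ae_succ s] with s' h
        rw [h.eq_of_term hs.1]
      simp only [hitValue] at this ⊢
      rw [this]
      simp
    · simp only [hitValue]
      rw [indicator_of_notMem hs]
      exact zero_le
  | succ n ih => exact lintegral_mono fun s' => ih s'

/-- `hitProb` is harmonic, by monotone convergence. -/
theorem lintegral_hitProb (hB : MeasurableSet B) (s : State L V) :
    ∫⁻ s', C.hitProb B s' ∂C.step s = C.hitProb B s := by
  have hmono : ∀ s, Monotone fun n => C.hitValue B n s := fun s =>
    monotone_nat_of_le_succ fun n => hitValue_le_succ n s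
  simp only [hitProb]
  rw [lintegral_iSup (measurable_hitValue hB) (fun n m h s => hmono s h)]
  exact (hmono s).iSup_nat_add 1

theorem le_hitProb_of_term {s : State L V} (hs : s.1 = C.termLoc) :
    B.indicator 1 (C.outVal s.2) ≤ C.hitProb B s := by
  refine le_iSup_of_le 0 (le_of_eq ?_)
  by_cases h : C.outVal s.2 ∈ B <;> simp [hitValue, indicator, h, hs]

/-- For the initial state, `hitProb` is bounded by the probability under the law of the process.
By the Markov property, `hitValue` can be evaluated along the process. -/
theorem hitProb_init_le (hB : MeasurableSet B) :
    C.hitProb B C.init ≤ C.prob (C.outputIn B) := by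
  have hstep : ∀ n k, ∫⁻ ρ, C.hitValue B (n + 1) (ρ k) ∂C.prob =
      ∫⁻ ρ, C.hitValue B n (ρ (k + 1)) ∂C.prob := fun n k =>
    (C.lintegral_prob_succ k (F := fun _ s' => C.hitValue B n s')
      ((measurable_hitValue hB n).comp measurable_snd)).symm
  have hshift : ∀ n k, ∫⁻ ρ, C.hitValue B n (ρ k) ∂C.prob =
      ∫⁻ ρ, C.hitValue B 0 (ρ (k + n)) ∂C.prob := fun n => by
    induction n with
    | zero => exact fun k => rfl
    | succ n ih => exact fun k => by rw [hstep, ih, add_right_comm, add_assoc]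
  refine iSup_le fun n => ?_
  have h0 : ∫⁻ ρ, C.hitValue B n (ρ 0) ∂C.prob = C.hitValue B n C.init := by
    have h := lintegral_map (μ := C.prob) (measurable_hitValue (C := C) hB n)
      (g := fun ρ : ℕ → State L V => ρ 0) (measurable_pi_apply 0)
    rw [← h, prob_map_zero, lintegral_dirac]
  rw [← h0, hshift, ← lintegral_indicator_one (measurableSet_outputIn hB)]
  refine lintegral_mono fun ρ => ?_
  change {s : State L V | s.1 = C.termLoc ∧ C.outVal s.2 ∈ B}.indicator 1 (ρ (0 + n)) ≤ _
  by_cases h : ρ (0 + n) ∈ {s : State L V | s.1 = C.termLoc ∧ C.outVal s.2 ∈ B}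
  · have h' : ρ ∈ C.outputIn B := ⟨0 + n, h⟩
    rw [indicator_of_mem h, indicator_of_mem h']
    exact le_rfl
  · rw [indicator_of_notMem h]
    exact zero_le

theorem aemeasurable_cumWeight (hT : C.AlmostSurelyTerminating)
    (hw : ∀ x, C.weight (C.termLoc, C.termLoc) x = 1) : AEMeasurable C.cumWeight C.prob := by
  refine aemeasurable_of_tendsto_metrizable_ae'
    (f := fun n ρ => ∏ i ∈ Finset.range n, C.stepWeight (ρ i)) (fun n => ?_) ?_
  · exact (Finset.measurable_prod _ fun i _ =>
      C.measurable_stepWeight.comp (measurable_pi_apply i)).aemeasurable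
  · filter_upwards [hT, C.ae_isRun] with ρ ⟨n, hn⟩ hρ
    refine tendsto_const_nhds.congr' (eventually_atTop.2 ⟨n, fun m hm => ?_⟩)
    exact hρ.cumWeight_eq hw (by rw [hρ.eq_of_le hn hm, hn])

end PCFG

/-! ### Steps of a program -/

theorem pi_dirac {ι : Type*} [Fintype ι] (x : ι → ℝ) :
    Measure.pi (fun i => Measure.dirac (x i)) = Measure.dirac x := by
  refine Measure.pi_eq fun s hs => ?_
  rw [Measure.dirac_apply' _ (MeasurableSet.univ_pi hs)]
  simp only [Measure.dirac_apply' _ (hs _)]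
  by_cases h : x ∈ univ.pi s
  · rw [indicator_of_mem h, Finset.prod_eq_one fun i _ => indicator_of_mem (h i trivial) _]
    rfl
  · rw [indicator_of_notMem h]
    obtain ⟨i, hi⟩ : ∃ i, x i ∉ s i := by simpa [mem_univ_pi] using h
    exact (Finset.prod_eq_zero (Finset.mem_univ i) (indicator_of_notMem hi _)).symm

namespace Program

variable {L V O : Type*} (P : Program L V O)

theorem nextLoc_eq {ℓ : Option L} {x : V → ℝ} {ℓ' : Option L} (h : (ℓ, ℓ') ∈ P.trans)
    (h' : x ∈ P.guard (ℓ, ℓ')) : P.toPCFG.nextLoc ℓ x = ℓ' :=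
  (P.toPCFG.nextLoc_eq_iff ℓ ℓ' x).2 ⟨h, h'⟩

theorem weight_exit (x : V → ℝ) : P.toPCFG.weight (P.toPCFG.termLoc, P.toPCFG.termLoc) x = 1 := rfl

theorem stepWeight_none (x : V → ℝ) : P.toPCFG.stepWeight (State.mk none x) = 1 := rfl

variable {P}

section Step

variable [Finite L] [Fintype V]

theorem step_of_keep {ℓ : Option L} {x : V → ℝ} {ℓ' : Option L} (h : (ℓ, ℓ') ∈ P.trans)
    (h' : x ∈ P.guard (ℓ, ℓ')) (hup : P.up (ℓ, ℓ') = fun _ => .keep) :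
    P.toPCFG.step (State.mk ℓ x) = Measure.dirac (State.mk ℓ' x) := by
  have hlaw : P.toPCFG.nextLaw (ℓ, ℓ') x = Measure.dirac x := by
    have : P.toPCFG.up (ℓ, ℓ') = fun _ => .keep := hup
    rw [PCFG.nextLaw, this]
    exact pi_dirac x
  have := P.toPCFG.step_apply (State.mk ℓ x)
  change _ = (P.toPCFG.nextLaw (ℓ, P.toPCFG.nextLoc ℓ x) x).map
    (State.mk (P.toPCFG.nextLoc ℓ x)) at this
  rw [this, P.nextLoc_eq h h', hlaw, Measure.map_dirac' (PCFG.measurable_mk _)]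

theorem step_none (x : V → ℝ) :
    P.toPCFG.step (State.mk none x) = Measure.dirac (State.mk none x) :=
  step_of_keep rfl trivial rfl

theorem lintegral_step_update {ℓ : L} {u : V → Update V} (h : P.instr ℓ = .update u) (x : V → ℝ)
    {g : State (Option L) V → ℝ≥0∞} (hg : Measurable g) :
    ∫⁻ s, g s ∂P.toPCFG.step (State.mk (some ℓ) x) =
      ∫⁻ y, g (State.mk (P.next ℓ) y) ∂Measure.pi fun v => (u v).law v x := by
  have hn : P.toPCFG.nextLoc (some ℓ) x = P.next ℓ :=
    P.nextLoc_eq (by simp [trans, h]) (by simp [guard, h])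
  have hlaw : P.toPCFG.nextLaw (some ℓ, P.next ℓ) x = Measure.pi fun v => (u v).law v x := by
    have : P.toPCFG.up (some ℓ, P.next ℓ) = u := by
      change P.up (some ℓ, P.next ℓ) = u
      simp only [up, h]
    rw [PCFG.nextLaw, this]
  rw [PCFG.lintegral_step _ _ hg]
  change ∫⁻ y, g (State.mk (P.toPCFG.nextLoc (some ℓ) x) y)
    ∂P.toPCFG.nextLaw (some ℓ, P.toPCFG.nextLoc (some ℓ) x) x = _
  rw [hn, hlaw]

open Classical in
theorem step_branch {ℓ : L} {φ : Set (V → ℝ)} {hφ : MeasurableSet φ} {a : Option L}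
    (h : P.instr ℓ = .branch φ hφ a) (x : V → ℝ) :
    P.toPCFG.step (State.mk (some ℓ) x) =
      Measure.dirac (State.mk (if x ∈ φ then P.next ℓ else a) x) := by
  refine step_of_keep ?_ ?_ ?_
  · by_cases hx : x ∈ φ <;> simp [trans, h, hx]
  · by_cases hx : x ∈ φ <;> simp [guard, h, hx]
  · simp [up, h]

theorem step_observe {ℓ : L} {φ : Set (V → ℝ)} {hφ : MeasurableSet φ}
    (h : P.instr ℓ = .observe φ hφ) (x : V → ℝ) :
    P.toPCFG.step (State.mk (some ℓ) x) = Measure.dirac (State.mk (P.next ℓ) x) :=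
  step_of_keep (by simp [trans, h]) (by simp [guard, h]) (by simp [up, h])

theorem step_score {ℓ : L} {e : (V → ℝ) → ℝ≥0} {he : Measurable e}
    (h : P.instr ℓ = .score e he) (x : V → ℝ) :
    P.toPCFG.step (State.mk (some ℓ) x) = Measure.dirac (State.mk (P.next ℓ) x) :=
  step_of_keep (by simp [trans, h]) (by simp [guard, h]) (by simp [up, h])

end Step

theorem stepWeight_some (ℓ : L) (x : V → ℝ) : P.toPCFG.stepWeight (State.mk (some ℓ) x) =
    P.weight (some ℓ, P.toPCFG.nextLoc (some ℓ) x) x := rfl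

theorem stepWeight_update {ℓ : L} {u : V → Update V} (h : P.instr ℓ = .update u) (x : V → ℝ) :
    P.toPCFG.stepWeight (State.mk (some ℓ) x) = 1 := by
  simp only [stepWeight_some, weight, h]

theorem stepWeight_branch {ℓ : L} {φ : Set (V → ℝ)} {hφ : MeasurableSet φ} {a : Option L}
    (h : P.instr ℓ = .branch φ hφ a) (x : V → ℝ) :
    P.toPCFG.stepWeight (State.mk (some ℓ) x) = 1 := by
  simp only [stepWeight_some, weight, h]

open Classical in
theorem stepWeight_observe {ℓ : L} {φ : Set (V → ℝ)} {hφ : MeasurableSet φ}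
    (h : P.instr ℓ = .observe φ hφ) (x : V → ℝ) :
    P.toPCFG.stepWeight (State.mk (some ℓ) x) = if x ∈ φ then 1 else 0 := by
  simp only [stepWeight_some, weight, h]

theorem stepWeight_score {ℓ : L} {e : (V → ℝ) → ℝ≥0} {he : Measurable e}
    (h : P.instr ℓ = .score e he) (x : V → ℝ) :
    P.toPCFG.stepWeight (State.mk (some ℓ) x) = e x := by
  simp only [stepWeight_some, weight, h]

end Program

end PP

/-! ### Weighted restarting -/

namespace PP

variable {L V O : Type*}

/-- The valuation of the restarted program with the given values of the original variables, of the
weight variable and of the coin. -/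
def resVal (x : V → ℝ) (w c : ℝ) : ResVar V → ℝ
  | .orig v => x v
  | .weight => w
  | .coin => c

theorem origVal_resVal (x : V → ℝ) (w c : ℝ) : origVal (resVal x w c) = x := rfl

theorem measurable_resVal : Measurable fun p : (V → ℝ) × ℝ × ℝ => resVal p.1 p.2.1 p.2.2 := by
  refine measurable_pi_lambda _ fun v => ?_
  rcases v with v | _ | _ <;> simp only [resVal] <;> fun_prop

theorem Update.law_lift (u : Update V) (v : V) (x : ResVar V → ℝ) :
    u.lift.law (.orig v) x = u.law v (origVal x) := by
  cases u <;> rfl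

theorem pi_resVar [Fintype V] (μ : ResVar V → Measure ℝ) [∀ v, IsProbabilityMeasure (μ v)] :
    Measure.pi μ = (((Measure.pi fun v => μ (.orig v)).prod
      ((μ .weight).prod (μ .coin))).map fun p => resVal p.1 p.2.1 p.2.2) := by
  refine Measure.pi_eq fun s hs => ?_
  rw [Measure.map_apply measurable_resVal (MeasurableSet.univ_pi hs)]
  have : (fun p : (V → ℝ) × ℝ × ℝ => resVal p.1 p.2.1 p.2.2) ⁻¹' univ.pi s =
      (univ.pi fun v => s (.orig v)) ×ˢ (s .weight ×ˢ s .coin) := by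
    ext p
    simp only [mem_preimage, mem_univ_pi, mem_prod]
    constructor
    · exact fun h => ⟨fun v => h (.orig v), h .weight, h .coin⟩
    · rintro ⟨h1, h2, h3⟩ (v | _ | _)
      exacts [h1 v, h2, h3]
  rw [this, Measure.prod_prod, Measure.prod_prod, Measure.pi_pi]
  let e : V ⊕ Bool ≃ ResVar V :=
    { toFun := fun s => match s with
        | .inl v => .orig v
        | .inr true => .weight
        | .inr false => .coin
      invFun := fun s => match s with
        | .orig v => .inl v
        | .weight => .inr true
        | .coin => .inr false
      left_inv := by rintro (v | _ | _) <;> rfl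
      right_inv := by rintro (v | _ | _) <;> rfl }
  rw [← e.prod_comp]
  simp only [Fintype.prod_sum_type, Fintype.prod_bool]
  rfl

theorem lintegral_pi_resVar [Fintype V] (μ : ResVar V → Measure ℝ)
    [∀ v, IsProbabilityMeasure (μ v)] {g : (ResVar V → ℝ) → ℝ≥0∞} (hg : Measurable g) :
    ∫⁻ y, g y ∂Measure.pi μ = ∫⁻ x, ∫⁻ w, ∫⁻ c, g (resVal x w c) ∂μ .coin ∂μ .weight
      ∂Measure.pi fun v => μ (.orig v) := by
  have hg' := hg.comp measurable_resVal
  rw [pi_resVar, lintegral_map hg measurable_resVal]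
  exact (lintegral_prod _ hg'.aemeasurable).trans <| lintegral_congr fun x =>
    lintegral_prod _ (hg'.comp measurable_prodMk_left).aemeasurable

theorem uniform01_lintegral_ge {t : ℝ} (h0 : 0 ≤ t) (h1 : t ≤ 1) (a b : ℝ≥0∞) :
    ENNReal.ofReal t * a + ENNReal.ofReal (1 - t) * b ≤
      ∫⁻ c, (if c ≤ t then a else b) ∂(uniform01 : Measure ℝ) := by
  change _ ≤ ∫⁻ c, (if c ≤ t then a else b) ∂volume.restrict (Icc 0 1)
  rw [← Icc_union_Ioc_eq_Icc h0 h1, lintegral_union measurableSet_Ioc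
    (Set.disjoint_left.2 fun c hc hc' => hc'.1.not_ge hc.2)]
  refine add_le_add (le_of_eq ?_) (le_of_eq ?_)
  · rw [setLIntegral_congr_fun measurableSet_Icc (g := fun _ => a) fun c hc => if_pos hc.2,
      setLIntegral_const, Real.volume_Icc, sub_zero, mul_comm]
  · rw [setLIntegral_congr_fun measurableSet_Ioc (g := fun _ => b)
      fun c hc => if_neg (not_le.2 hc.1), setLIntegral_const, Real.volume_Ioc, mul_comm]

namespace Program

variable {P : Program L V O} {M : ℝ}

theorem resInstr_update {ℓ : L} {u : V → Update V} (h : P.instr ℓ = .update u) :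
    P.resInstr ℓ = .update fun
      | .orig v => (u v).lift
      | .weight => .keep
      | .coin => .keep := by
  unfold resInstr
  split <;> simp_all

theorem resInstr_branch {ℓ : L} {φ : Set (V → ℝ)} {hφ : MeasurableSet φ} {a : Option L}
    (h : P.instr ℓ = .branch φ hφ a) :
    P.resInstr ℓ = .branch (origVal ⁻¹' φ) (measurable_origVal hφ) (P.liftPoint a) := by
  unfold resInstr
  split <;> simp_all

theorem resInstr_observe {ℓ : L} {φ : Set (V → ℝ)} {hφ : MeasurableSet φ}
    (h : P.instr ℓ = .observe φ hφ) :
    P.resInstr ℓ = .branch (origVal ⁻¹' φ) (measurable_origVal hφ)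
      (some (.zero ℓ ⟨φ, hφ, h⟩)) := by
  unfold resInstr
  split <;> rename_i h' <;> rw [h] at h' <;> injection h'
  subst_vars
  rfl

theorem resInstr_score {ℓ : L} {e : (V → ℝ) → ℝ≥0} {he : Measurable e}
    (h : P.instr ℓ = .score e he) :
    P.resInstr ℓ = .update (setWeight (fun x => x .weight * (e (origVal x) : ℝ))
      ((measurable_pi_apply _).mul (he.comp measurable_origVal).coe_nnreal_real)) := by
  unfold resInstr
  split <;> rename_i h' <;> rw [h] at h' <;> injection h'
  subst_vars
  rfl

variable [Finite L] [Fintype V] {B : Set (O → ℝ)}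

variable (P M B) in
/-- The probability that the restarted program terminates with an output in `B`, from the state
that corresponds to a state of the program and a weight. The exit of the program corresponds to
the block that is added at the end. -/
noncomputable def resProb (s : State (Option L) V) (w : ℝ≥0) : ℝ≥0∞ :=
  (P.restart M).toPCFG.hitProb B (State.mk (P.liftPoint s.1) (resVal s.2 w 0))

theorem resProb_mk (ℓ : Option L) (x : V → ℝ) (w : ℝ≥0) :
    P.resProb M B (State.mk ℓ x) w =
      (P.restart M).toPCFG.hitProb B (State.mk (P.liftPoint ℓ) (resVal x w 0)) :=
  rfl

theorem measurable_resProb (hB : MeasurableSet B) :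
    Measurable fun p : State (Option L) V × ℝ≥0 => P.resProb M B p.1 p.2 := by
  refine (PCFG.measurable_hitProb hB).comp (State.measurable_of_loc_prod
    (F := fun ℓ x (w : ℝ≥0) => State.mk (P.liftPoint ℓ) (resVal x w 0)) fun ℓ => ?_)
  have h : Measurable fun q : (V → ℝ) × ℝ≥0 => (q.1, (q.2 : ℝ), (0 : ℝ)) := by fun_prop
  exact (PCFG.measurable_mk _).comp (measurable_resVal.comp h)

theorem hitProb_update (hB : MeasurableSet B) {a : ResLabel P} {u : ResVar V → Update (ResVar V)}
    (h : (P.restart M).instr a = .update u) (y : ResVar V → ℝ) :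
    (P.restart M).toPCFG.hitProb B (State.mk (some a) y) =
      ∫⁻ x, ∫⁻ w, ∫⁻ c,
        (P.restart M).toPCFG.hitProb B (State.mk ((P.restart M).next a) (resVal x w c))
        ∂(u .coin).law .coin y ∂(u .weight).law .weight y
        ∂Measure.pi fun v => (u (.orig v)).law (.orig v) y := by
  have hm := PCFG.measurable_hitProb (C := (P.restart M).toPCFG) hB
  rw [← PCFG.lintegral_hitProb hB, lintegral_step_update h y hm]
  exact lintegral_pi_resVar (fun v => (u v).law v y) (hm.comp (PCFG.measurable_mk _))

theorem hitProb_update_dirac (hB : MeasurableSet B) {a : ResLabel P}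
    {u : ResVar V → Update (ResVar V)} (h : (P.restart M).instr a = .update u) {y : ResVar V → ℝ}
    {x : V → ℝ} {w c : ℝ} (hx : ∀ v, (u (.orig v)).law (.orig v) y = Measure.dirac (x v))
    (hw : (u .weight).law .weight y = Measure.dirac w)
    (hc : (u .coin).law .coin y = Measure.dirac c) :
    (P.restart M).toPCFG.hitProb B (State.mk (some a) y) =
      (P.restart M).toPCFG.hitProb B (State.mk ((P.restart M).next a) (resVal x w c)) := by
  simp only [hitProb_update hB h, hw, hc, lintegral_dirac, hx, pi_dirac]

open Classical in
theorem hitProb_branch (hB : MeasurableSet B) {a : ResLabel P} {φ : Set (ResVar V → ℝ)}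
    {hφ : MeasurableSet φ} {b : Option (ResLabel P)}
    (h : (P.restart M).instr a = .branch φ hφ b) (y : ResVar V → ℝ) :
    (P.restart M).toPCFG.hitProb B (State.mk (some a) y) =
      (P.restart M).toPCFG.hitProb B
        (State.mk (if y ∈ φ then (P.restart M).next a else b) y) := by
  have hm := PCFG.measurable_hitProb (C := (P.restart M).toPCFG) hB
  rw [← PCFG.lintegral_hitProb hB, step_branch h, lintegral_dirac' _ hm]

theorem hitProb_zero (hB : MeasurableSet B) (ℓ : L) (h : P.IsObserve ℓ) (x : V → ℝ) (w : ℝ) :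
    (P.restart M).toPCFG.hitProb B (State.mk (some (.zero ℓ h)) (resVal x w 0)) =
      P.resProb M B (State.mk (P.next ℓ) x) 0 :=
  hitProb_update_dirac hB (a := .zero ℓ h) rfl (fun _ => rfl) rfl rfl

/-- Along the program, with the weight updated, `resProb` is a supermartingale: a step of the
program corresponds to one step of the restarted program, or to two if an `observe` fails. -/
theorem lintegral_resProb_le (hB : MeasurableSet B) (s : State (Option L) V) (w : ℝ≥0) :
    ∫⁻ s', P.resProb M B s' (w * P.toPCFG.stepWeight s) ∂P.toPCFG.step s ≤ P.resProb M B s w := by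
  have hm : ∀ w, Measurable fun s' => P.resProb M B s' w := fun w =>
    (measurable_resProb hB).comp (measurable_id.prodMk measurable_const)
  obtain ⟨ℓ, x⟩ := s
  change ∫⁻ s', P.resProb M B s' (w * P.toPCFG.stepWeight (State.mk ℓ x))
    ∂P.toPCFG.step (State.mk ℓ x) ≤ P.resProb M B (State.mk ℓ x) w
  rcases ℓ with _ | ℓ
  · rw [stepWeight_none, step_none, mul_one, lintegral_dirac' _ (hm w)]
  cases h : P.instr ℓ with
  | update u =>
    rw [stepWeight_update h, lintegral_step_update h x (hm _), mul_one, resProb_mk]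
    have hres : (P.restart M).instr (.orig ℓ) = _ := resInstr_update h
    have hH := hitProb_update hB hres (resVal x w 0)
    simp only [Update.law_lift, origVal_resVal] at hH
    refine le_of_eq (Eq.trans (lintegral_congr fun y => ?_) hH.symm)
    exact ((lintegral_dirac (w : ℝ) _).trans (lintegral_dirac (0 : ℝ) _)).symm
  | branch φ hφ a =>
    rw [stepWeight_branch h, step_branch h, lintegral_dirac' _ (hm _), mul_one]
    have hres : (P.restart M).instr (.orig ℓ) = _ := resInstr_branch h
    refine le_of_eq (Eq.trans ?_ (hitProb_branch hB hres (resVal x w 0)).symm)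
    by_cases hx : x ∈ φ
    · rw [if_pos hx, if_pos (by exact hx)]
      rfl
    · rw [if_neg hx, if_neg (by exact hx)]
      rfl
  | observe φ hφ =>
    rw [stepWeight_observe h, step_observe h, lintegral_dirac' _ (hm _)]
    have hres : (P.restart M).instr (.orig ℓ) = _ := resInstr_observe h
    refine le_of_eq (Eq.trans ?_ (hitProb_branch hB hres (resVal x w 0)).symm)
    by_cases hx : x ∈ φ
    · rw [if_pos hx, if_pos (by exact hx), mul_one]
      rfl
    · rw [if_neg hx, if_neg (by exact hx), mul_zero]
      exact (hitProb_zero hB ℓ ⟨φ, hφ, h⟩ x w).symm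
  | score e he =>
    rw [stepWeight_score h, step_score h, lintegral_dirac' _ (hm _)]
    have hres : (P.restart M).instr (.orig ℓ) = _ := resInstr_score h
    refine le_of_eq (hitProb_update_dirac hB hres (y := resVal x w 0) (fun _ => rfl) ?_ rfl).symm
    change Measure.dirac ((w : ℝ) * (e x : ℝ)) = _
    rw [NNReal.coe_mul]

theorem resProb_init : P.resProb M B P.toPCFG.init 1 =
    (P.restart M).toPCFG.hitProb B (P.restart M).toPCFG.init := by
  have : resVal P.initVal ((1 : ℝ≥0) : ℝ) 0 = (P.restart M).initVal := by
    funext v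
    rcases v with v | _ | _ <;> simp [resVal, restart]
  change (P.restart M).toPCFG.hitProb B (State.mk _ (resVal P.initVal ((1 : ℝ≥0) : ℝ) 0)) = _
  rw [this]
  rfl

/-- At the exit of the program: the block that is added at the end restarts with
probability `1 - w / M`, and outputs with probability `w / M`. -/
theorem le_resProb_none (hB : MeasurableSet B) (hM : 0 < M) (x : V → ℝ) {w : ℝ≥0}
    (hw : (w : ℝ) ≤ M) :
    ENNReal.ofReal (1 - w / M) * P.resProb M B P.toPCFG.init 1 +
      ENNReal.ofReal (w / M) * B.indicator 1 (P.toPCFG.outVal x) ≤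
    P.resProb M B (State.mk none x) w := by
  set H := (P.restart M).toPCFG.hitProb B with hH
  have hdraw : P.resProb M B (State.mk none x) w =
      ∫⁻ c, H (State.mk (some .test) (resVal x w c)) ∂(uniform01 : Measure ℝ) := by
    have h := hitProb_update (M := M) hB (a := (ResLabel.draw : ResLabel P)) rfl (resVal x w 0)
    have hpi : (Measure.pi fun v : V => Update.keep.law (ResVar.orig v) (resVal x w 0)) =
        Measure.dirac x := pi_dirac x
    have hm : Measurable fun p : (V → ℝ) × ℝ =>
        H (State.mk (some .test) (resVal p.1 w p.2)) :=
      (PCFG.measurable_hitProb hB).comp ((PCFG.measurable_mk _).comp (measurable_resVal.comp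
        (measurable_fst.prodMk (measurable_const.prodMk measurable_snd))))
    refine h.trans ?_
    rw [hpi]
    calc _ = ∫⁻ x', ∫⁻ c, H (State.mk (some .test) (resVal x' w c)) ∂(uniform01 : Measure ℝ)
          ∂Measure.dirac x := lintegral_congr fun x' => lintegral_dirac (w : ℝ) _
      _ = _ := lintegral_dirac' _ hm.lintegral_prod_right'
  have hreset : ∀ y, H (State.mk (some .reset) y) = P.resProb M B P.toPCFG.init 1 := fun y => by
    have h := hitProb_update_dirac (M := M) hB (a := (ResLabel.reset : ResLabel P)) rfl (y := y)
      (x := P.initVal) (w := ((1 : ℝ≥0) : ℝ)) (c := 0) (fun _ => rfl)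
      (by rw [NNReal.coe_one]; rfl) rfl
    exact h
  have htest : ∀ c, (if c ≤ 1 - w / M then P.resProb M B P.toPCFG.init 1
      else B.indicator 1 (P.toPCFG.outVal x)) ≤ H (State.mk (some .test) (resVal x w c)) := by
    intro c
    rw [hH, hitProb_branch hB (a := (ResLabel.test : ResLabel P)) rfl]
    by_cases hc : c ≤ 1 - w / M
    · rw [if_pos hc, if_pos (by exact hc)]
      exact (hreset _).ge
    · rw [if_neg hc, if_neg (by exact hc)]
      exact PCFG.le_hitProb_of_term (C := (P.restart M).toPCFG)
        (s := State.mk none (resVal x w c)) rfl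
  rw [hdraw]
  refine le_trans ?_ (lintegral_mono htest)
  have h1 : (w : ℝ) / M ≤ 1 := (div_le_one hM).2 hw
  have h0 : 0 ≤ (w : ℝ) / M := by positivity
  have := uniform01_lintegral_ge (t := 1 - w / M) (by linarith) (by linarith)
    (P.resProb M B P.toPCFG.init 1) (B.indicator 1 (P.toPCFG.outVal x))
  rwa [sub_sub_cancel] at this

/-- The expected value of `resProb` at any time is at most its initial value. -/
theorem lintegral_resProb_prob_le (hB : MeasurableSet B) (n : ℕ) :
    ∫⁻ ρ, P.resProb M B (ρ n) (∏ i ∈ Finset.range n, P.toPCFG.stepWeight (ρ i)) ∂P.toPCFG.prob ≤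
      P.resProb M B P.toPCFG.init 1 := by
  induction n with
  | zero =>
    have : ∀ᵐ ρ ∂P.toPCFG.prob, P.resProb M B (ρ 0)
        (∏ i ∈ Finset.range 0, P.toPCFG.stepWeight (ρ i)) =
        P.resProb M B P.toPCFG.init 1 := by
      filter_upwards [P.toPCFG.ae_isRun] with ρ hρ
      rw [hρ.1, Finset.prod_range_zero]
    rw [lintegral_congr_ae this]
    simp
  | succ n ih =>
    have hprod : ∀ ρ : ℕ → State (Option L) V,
        ∏ i ∈ Finset.range (n + 1), P.toPCFG.stepWeight (ρ i) =
          ∏ i : Finset.Iic n, P.toPCFG.stepWeight (ρ i) := fun ρ => by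
      rw [Finset.prod_coe_sort (Finset.Iic n) fun i => P.toPCFG.stepWeight (ρ i)]
      congr 1
      ext i
      simp
    have hmw : Measurable fun p : ((i : Finset.Iic n) → State (Option L) V) × State (Option L) V =>
        ∏ i : Finset.Iic n, P.toPCFG.stepWeight (p.1 i) :=
      Finset.measurable_prod _ fun i _ => P.toPCFG.measurable_stepWeight.comp
        ((measurable_pi_apply i).comp measurable_fst)
    have h := P.toPCFG.lintegral_prob_succ n
      (F := fun h s' => P.resProb M B s' (∏ i : Finset.Iic n, P.toPCFG.stepWeight (h i)))
      ((measurable_resProb hB).comp (measurable_snd.prodMk hmw))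
    simp only [hprod]
    refine h.le.trans (le_trans (lintegral_mono fun ρ => ?_) ih)
    rw [← hprod, Finset.prod_range_succ]
    exact lintegral_resProb_le hB (ρ n) _

/-- The output probabilities of the restarted program are at least those of the normalized output
distribution. If `α` is the probability of an output in `B`, then considering the first iteration
gives `α ≥ α * 𝔼[1 - W / M] + 𝔼[W / M; out ∈ B]`, which is solved for `α`; here the almost sure
bound `W ≤ M`, and `0 < 𝔼[W] < ∞`, are needed. -/
theorem nod_le_prob_restart (hT : P.toPCFG.AlmostSurelyTerminating)
    (hint : P.toPCFG.IntegrableWeight) (hM : 0 < M) (hbound : P.toPCFG.WeightBoundedBy M)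
    (hB : MeasurableSet B) :
    P.toPCFG.nod B ≤ (P.restart M).toPCFG.prob ((P.restart M).toPCFG.outputIn B) := by
  set C := P.toPCFG with hC
  set α := P.resProb M B C.init 1 with hα
  have hαle : α ≤ (P.restart M).toPCFG.prob ((P.restart M).toPCFG.outputIn B) :=
    (resProb_init (M := M)).trans_le (PCFG.hitProb_init_le hB)
  refine le_trans ?_ hαle
  have hαtop : α ≠ ⊤ := (hαle.trans_lt (measure_lt_top _ _)).ne
  have hcw := PCFG.aemeasurable_cumWeight hT P.weight_exit
  set G : (ℕ → State (Option L) V) → ℝ≥0∞ := fun ρ =>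
    ENNReal.ofReal (1 - C.cumWeight ρ / M) * α +
      ENNReal.ofReal (C.cumWeight ρ / M) * (C.outputIn B).indicator 1 ρ with hG
  have hGle : ∫⁻ ρ, G ρ ∂C.prob ≤ α := by
    have hF : ∀ n, Measurable fun ρ : ℕ → State (Option L) V =>
        P.resProb M B (ρ n) (∏ i ∈ Finset.range n, C.stepWeight (ρ i)) := fun n =>
      (measurable_resProb hB).comp ((measurable_pi_apply n).prodMk
        (Finset.measurable_prod _ fun i _ =>
          C.measurable_stepWeight.comp (measurable_pi_apply i)))
    -- Fatou's lemma: after termination `resProb` is at least `G`.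
    calc ∫⁻ ρ, G ρ ∂C.prob
        ≤ ∫⁻ ρ, liminf (fun n =>
            P.resProb M B (ρ n) (∏ i ∈ Finset.range n, C.stepWeight (ρ i))) atTop ∂C.prob := by
          refine lintegral_mono_ae ?_
          filter_upwards [hT, C.ae_isRun] with ρ hTρ hρ
          obtain ⟨n, hn⟩ := id hTρ
          refine le_liminf_of_le (by isBoundedDefault) (eventually_atTop.2 ⟨n, fun m hm => ?_⟩)
          have hm' : (ρ m).1 = C.termLoc := by rw [hρ.eq_of_le hn hm, hn]
          rw [← hρ.cumWeight_eq P.weight_exit hm']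
          have hle := le_resProb_none (P := P) hB hM (ρ m).2 (hbound ρ hρ hTρ)
          have hs : ρ m = State.mk none (ρ m).2 := Prod.ext hm' rfl
          have hind : (C.outputIn B).indicator (1 : (ℕ → State (Option L) V) → ℝ≥0∞) ρ =
              B.indicator 1 (C.outVal (ρ m).2) := by
            have := hρ.mem_outputIn_iff hTρ B
            rw [hρ.output_eq hm'] at this
            by_cases hmem : C.outVal (ρ m).2 ∈ B
            · rw [indicator_of_mem hmem, indicator_of_mem (this.2 hmem)]
              rfl
            · rw [indicator_of_notMem hmem, indicator_of_notMem fun h => hmem (this.1 h)]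
          rw [hs, hG]
          dsimp only
          rw [hind]
          exact hle
      _ ≤ liminf (fun n => ∫⁻ ρ, P.resProb M B (ρ n)
            (∏ i ∈ Finset.range n, C.stepWeight (ρ i)) ∂C.prob) atTop := lintegral_liminf_le hF
      _ ≤ α := by
          refine liminf_le_of_le (by isBoundedDefault) fun b hb => ?_
          obtain ⟨n, hn⟩ := hb.exists
          exact hn.trans (lintegral_resProb_prob_le hB n)
  -- `a` and `b` are the probabilities of a restart and of a stop at the end of the first iteration;
  -- `c` is the probability of a stop with an output in `B`.
  set a := ∫⁻ ρ, ENNReal.ofReal (1 - C.cumWeight ρ / M) ∂C.prob with ha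
  set b := ∫⁻ ρ, ENNReal.ofReal (C.cumWeight ρ / M) ∂C.prob with hb
  set c := ∫⁻ ρ, ENNReal.ofReal (C.cumWeight ρ / M) * (C.outputIn B).indicator 1 ρ ∂C.prob with hc
  have hma : AEMeasurable (fun ρ => ENNReal.ofReal (1 - C.cumWeight ρ / M)) C.prob :=
    (((hcw.coe_nnreal_real).div_const M).const_sub 1).ennreal_ofReal
  have hmb : AEMeasurable (fun ρ => ENNReal.ofReal (C.cumWeight ρ / M)) C.prob :=
    ((hcw.coe_nnreal_real).div_const M).ennreal_ofReal
  have hGeq : ∫⁻ ρ, G ρ ∂C.prob = a * α + c := by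
    rw [hG, lintegral_add_left' (hma.mul_const _), lintegral_mul_const' _ _ hαtop]
  have hab : a + b = 1 := by
    rw [ha, hb, ← lintegral_add_left' hma]
    have : ∀ᵐ ρ ∂C.prob, ENNReal.ofReal (1 - C.cumWeight ρ / M) +
        ENNReal.ofReal (C.cumWeight ρ / M) = 1 := by
      filter_upwards [hT, C.ae_isRun] with ρ hTρ hρ
      have h1 : (C.cumWeight ρ : ℝ) / M ≤ 1 := (div_le_one hM).2 (hbound ρ hρ hTρ)
      rw [← ENNReal.ofReal_add (by linarith) (by positivity), sub_add_cancel, ENNReal.ofReal_one]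
    rw [lintegral_congr_ae this]
    simp
  have hdiv : ∀ w : ℝ≥0, ENNReal.ofReal (w / M) = (ENNReal.ofReal M)⁻¹ * w := fun w => by
    rw [ENNReal.ofReal_div_of_pos hM, ENNReal.ofReal_coe_nnreal, mul_comm, div_eq_mul_inv]
  have hMne : (ENNReal.ofReal M)⁻¹ ≠ ⊤ := ENNReal.inv_ne_top.2 (by simpa using hM)
  have hM0 : (ENNReal.ofReal M)⁻¹ ≠ 0 := ENNReal.inv_ne_zero.2 ENNReal.ofReal_ne_top
  have hbE : b = (ENNReal.ofReal M)⁻¹ * C.expWeight := by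
    simp only [hb, hdiv, lintegral_const_mul' _ _ hMne, PCFG.expWeight]
  have hcE : c = (ENNReal.ofReal M)⁻¹ *
      ∫⁻ ρ, (C.outputIn B).indicator (fun ρ => (C.cumWeight ρ : ℝ≥0∞)) ρ ∂C.prob := by
    rw [hc, ← lintegral_const_mul' _ _ hMne]
    refine lintegral_congr fun ρ => ?_
    by_cases h : ρ ∈ C.outputIn B <;> simp [h, hdiv]
  rw [hGeq] at hGle
  have hαa : a * α ≠ ⊤ := (le_self_add.trans_lt (hGle.trans_lt hαtop.lt_top)).ne
  have hle : c ≤ b * α := by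
    have : a * α + c ≤ a * α + b * α := by rwa [← add_mul, hab, one_mul]
    exact (ENNReal.add_le_add_iff_left hαa).1 this
  rw [hbE, hcE, mul_assoc, ENNReal.mul_le_mul_iff_right hM0 hMne] at hle
  rw [PCFG.nod, ENNReal.div_le_iff hint.1.ne' hint.2.ne, mul_comm]
  exact hle

theorem one_le_nod_add_nod_compl (hT : P.toPCFG.AlmostSurelyTerminating)
    (hint : P.toPCFG.IntegrableWeight) (hB : MeasurableSet B) :
    1 ≤ P.toPCFG.nod B + P.toPCFG.nod Bᶜ := by
  have hcw := (PCFG.aemeasurable_cumWeight hT P.weight_exit).coe_nnreal_ennreal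
  rw [PCFG.nod, PCFG.nod, ← ENNReal.add_div,
    ← lintegral_add_left' (hcw.indicator (PCFG.measurableSet_outputIn hB)),
    ENNReal.le_div_iff_mul_le (Or.inl hint.1.ne') (Or.inl hint.2.ne), one_mul, PCFG.expWeight]
  refine lintegral_mono_ae ?_
  filter_upwards [hT, P.toPCFG.ae_isRun] with ρ hTρ hρ
  by_cases h : P.toPCFG.output ρ ∈ B
  · rw [indicator_of_mem ((hρ.mem_outputIn_iff hTρ B).2 h)]
    exact le_self_add
  · rw [indicator_of_mem ((hρ.mem_outputIn_iff hTρ Bᶜ).2 h)]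
    exact le_add_self

theorem restart_almostSurelyTerminating (hT : P.toPCFG.AlmostSurelyTerminating)
    (hint : P.toPCFG.IntegrableWeight) (hM : 0 < M) (hbound : P.toPCFG.WeightBoundedBy M) :
    (P.restart M).toPCFG.AlmostSurelyTerminating := by
  have h0 : P.toPCFG.nod ∅ = 0 := by simp [PCFG.nod, PCFG.outputIn]
  have h := one_le_nod_add_nod_compl hT hint MeasurableSet.empty
  rw [h0, zero_add, compl_empty] at h
  have h1 : (P.restart M).toPCFG.prob ((P.restart M).toPCFG.outputIn univ) = 1 :=
    le_antisymm prob_le_one (h.trans (nod_le_prob_restart hT hint hM hbound MeasurableSet.univ))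
  have h2 := (prob_compl_eq_zero_iff (PCFG.measurableSet_outputIn MeasurableSet.univ)).2 h1
  filter_upwards [measure_eq_zero_iff_ae_notMem.1 h2] with ρ hρ
  obtain ⟨n, hn, _⟩ := not_not.1 hρ
  exact ⟨n, hn⟩

/-- The restarted program has the normalized output distribution of the program as its output
distribution. -/
theorem map_output_restart (hT : P.toPCFG.AlmostSurelyTerminating)
    (hint : P.toPCFG.IntegrableWeight) (hM : 0 < M) (hbound : P.toPCFG.WeightBoundedBy M)
    (hB : MeasurableSet B) :
    (P.restart M).toPCFG.prob.map (P.restart M).toPCFG.output B = P.toPCFG.nod B := by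
  have hTr := restart_almostSurelyTerminating hT hint hM hbound
  have hle : ∀ B, MeasurableSet B → P.toPCFG.nod B ≤
      (P.restart M).toPCFG.prob.map (P.restart M).toPCFG.output B := fun B hB => by
    rw [PCFG.map_output_apply hTr hB]
    exact nod_le_prob_restart hT hint hM hbound hB
  have : IsProbabilityMeasure ((P.restart M).toPCFG.prob.map (P.restart M).toPCFG.output) :=
    Measure.isProbabilityMeasure_map (PCFG.aemeasurable_output hTr)
  refine le_antisymm ?_ (hle B hB)
  -- `B` and its complement both have at least their share, and the total mass is `1`.
  have h1 := hle Bᶜ hB.compl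
  have h2 : P.toPCFG.nod Bᶜ ≠ ⊤ := (h1.trans_lt (measure_lt_top _ _)).ne
  refine (ENNReal.add_le_add_iff_right h2).1 ?_
  calc _ ≤ _ := add_le_add_right h1 _
    _ = 1 := prob_add_prob_compl hB
    _ ≤ _ := one_le_nod_add_nod_compl hT hint hB

theorem OutputEquivalent.integral_eq {L₁ V₁ L₂ V₂ : Type*} [Finite L₁] [Fintype V₁] [Finite L₂]
    [Fintype V₂] {P₁ : Program L₁ V₁ O} {P₂ : Program L₂ V₂ O} (h : P₁.OutputEquivalent P₂)
    (hT₁ : P₁.toPCFG.AlmostSurelyTerminating) (hT₂ : P₂.toPCFG.AlmostSurelyTerminating)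
    (hint₁ : P₁.toPCFG.IntegrableWeight) (hint₂ : P₂.toPCFG.IntegrableWeight)
    {M₁ M₂ : ℝ} (hM₁ : 0 < M₁) (hM₂ : 0 < M₂)
    (hbound₁ : P₁.toPCFG.WeightBoundedBy M₁) (hbound₂ : P₂.toPCFG.WeightBoundedBy M₂)
    {f : (O → ℝ) → ℝ} (hf : Measurable f) :
    ∫ ρ, f ((P₁.restart M₁).toPCFG.output ρ) ∂(P₁.restart M₁).toPCFG.prob =
      ∫ ρ, f ((P₂.restart M₂).toPCFG.output ρ) ∂(P₂.restart M₂).toPCFG.prob := by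
  have hTr₁ := restart_almostSurelyTerminating hT₁ hint₁ hM₁ hbound₁
  have hTr₂ := restart_almostSurelyTerminating hT₂ hint₂ hM₂ hbound₂
  have hlaw : (P₁.restart M₁).toPCFG.prob.map (P₁.restart M₁).toPCFG.output =
      (P₂.restart M₂).toPCFG.prob.map (P₂.restart M₂).toPCFG.output := by
    ext B hB
    rw [map_output_restart hT₁ hint₁ hM₁ hbound₁ hB, map_output_restart hT₂ hint₂ hM₂ hbound₂ hB,
      h B hB]
  rw [← integral_map (PCFG.aemeasurable_output hTr₁) hf.aestronglyMeasurable, hlaw,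
    integral_map (PCFG.aemeasurable_output hTr₂) hf.aestronglyMeasurable]

end Program
end PP

/-! ### Refuting equivalence -/

/-- Equivalence refutation for probabilistic programs with conditioning. -/
theorem theorem2 {L₁ V₁ L₂ V₂ O : Type*} [Finite L₁] [Fintype V₁] [Finite L₂] [Fintype V₂]
    (P₁ : PP.Program L₁ V₁ O) (P₂ : PP.Program L₂ V₂ O)
    (hterm₁ : P₁.toPCFG.AlmostSurelyTerminating) (hterm₂ : P₂.toPCFG.AlmostSurelyTerminating)
    (hint₁ : P₁.toPCFG.IntegrableWeight) (hint₂ : P₂.toPCFG.IntegrableWeight)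
    (M₁ M₂ : ℝ) (hM₁ : 0 < M₁) (hM₂ : 0 < M₂)
    (hbound₁ : P₁.toPCFG.WeightBoundedBy M₁) (hbound₂ : P₂.toPCFG.WeightBoundedBy M₂)
    (f : (O → ℝ) → ℝ) (hf : Measurable f)
    (U : Option (PP.ResLabel P₁) → (PP.ResVar V₁ → ℝ) → ℝ)
    (L : Option (PP.ResLabel P₂) → (PP.ResVar V₂ → ℝ) → ℝ)
    (hU : (P₁.restart M₁).toPCFG.IsUESM f U) (hUost : (P₁.restart M₁).toPCFG.OSTSound U f)
    (hL : (P₂.restart M₂).toPCFG.IsLESM f L) (hLost : (P₂.restart M₂).toPCFG.OSTSound L f)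
    (hlt :
      U (P₁.restart M₁).toPCFG.initLoc (P₁.restart M₁).toPCFG.initVal
          + f ((P₁.restart M₁).toPCFG.outVal (P₁.restart M₁).toPCFG.initVal)
        < L (P₂.restart M₂).toPCFG.initLoc (P₂.restart M₂).toPCFG.initVal
          + f ((P₂.restart M₂).toPCFG.outVal (P₂.restart M₂).toPCFG.initVal)) :
    ¬ P₁.OutputEquivalent P₂ := by
  intro hequiv
  have hT₁ := PP.Program.restart_almostSurelyTerminating hterm₁ hint₁ hM₁ hbound₁
  have hT₂ := PP.Program.restart_almostSurelyTerminating hterm₂ hint₂ hM₂ hbound₂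
  have hle := hU.integral_output_le hf hUost hT₁
  have hge := hL.le_integral_output hf hLost hT₂
  have heq := hequiv.integral_eq hterm₁ hterm₂ hint₁ hint₂ hM₁ hM₂ hbound₁ hbound₂ hf
  linarith
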